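/- Let $d\in\mathbb{N}$, $u_0,v_0>0$, and let $|\cdot|$ and $\cdot$ be the Euclidean norm and inner product of $\mathbb{R}^{d+1}\supset\mathbb{S}^d$. Let $\phi_+:[0,u_0]\to\mathbb{S}^d$ and $\phi_-:[0,v_0]\to\mathbb{S}^d$ be absolutely continuous (equivalently, continuous with weak derivatives $\phi_+'\in L^1([0,u_0])$, $\phi_-'\in L^1([0,v_0])$) with $\phi_+(0)=\phi_-(0)$. A function $\phi:[0,u_0]\times[0,v_0]\to\mathbb{S}^d$ is called a wave map with boundary data $\phi_\pm$ if the classical partial derivatives $\partial_u\phi$, $\partial_v\phi$ exist almost everywhere, $\partial_u\phi\cdot\partial_v\phi$ and $(\partial_u\phi\cdot\partial_v\phi)\phi$ belong to $L^1([0,u_0]\times[0,v_0])$, and for all $(u,v)\in[0,u_0]\times[0,v_0]$ $$\phi(u,v)=\phi_+(u)+\phi_-(v)-\phi_+(0)-\int_0^u\int_0^v\big[(\partial_u\phi\cdot\partial_v\phi)\phi\big](w,z)\,dz\,dw.$$ Then the following hold. (i) There exists a unique wave map $\phi$ with boundary data $\phi_\pm$. Its mixed derivative $\partial_u\partial_v\phi$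 exists almost everywhere and belongs to $L^1([0,u_0]\times[0,v_0])$. (ii) If $\phi_+^{(n)}:[0,u_0]\to\mathbb{S}^d$ and $\phi_-^{(n)}:[0,v_0]\to\mathbb{S}^d$ are absolutely continuous with $\phi_+^{(n)}(0)=\phi_-^{(n)}(0)$ for every $n\in\mathbb{N}$, if $$\lim_{n\to\infty}\max\big(|\phi_+^{(n)}(0)-\phi_+(0)|,\ \|(\phi_+^{(n)})'-\phi_+'\|_{L^1([0,u_0])},\ \|(\phi_-^{(n)})'-\phi_-'\|_{L^1([0,v_0])}\big)=0,$$ and if $\phi^{(n)}$ is the wave map with boundary data $\phi_\pm^{(n)}$, then $$\lim_{n\to\infty}\|\partial_u\partial_v(\phi^{(n)}-\phi)\|_{L^1([0,u_0]\times[0,v_0])}=0.$$ (iii) The derivatives $\partial_u\phi(u,v_0)$ and $\partial_v\phi(u_0,v)$ exist for almost every $u\in[0,u_0]$, respectively $v\in[0,v_0]$, are integrable, and satisfy $$\int_0^{u_0}|\partial_u\phi(u,v_0)|\,du=\int_0^{u_0}|\phi_+'(u)|\,du,\qquad \int_0^{v_0}|\partial_v\phi(u_0,v)|\,dv=\int_0^{v_0}|\phi_-'(v)|\,dv.$$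 -/

import Mathlib

open MeasureTheory Set Filter Topology

namespace WaveMap

/-- The ambient Euclidean space `ℝ^{d+1}` of the sphere `S^d`. -/
abbrev Space (d : ℕ) : Type := EuclideanSpace ℝ (Fin (d + 1))

/-- The closed rectangle `[0, u₀] × [0, v₀]`. -/
def rect (u₀ v₀ : ℝ) : Set (ℝ × ℝ) := Icc 0 u₀ ×ˢ Icc 0 v₀

variable {d : ℕ}

/-- The classical partial derivative `∂_u φ (u, v)`. Functions on a rectangle are represented by
functions on the whole plane; at interior points the derivative sees only the values on the
rectangle, and the edges have measure zero. -/
noncomputable def du (φ : ℝ → ℝ → Space d) (u v : ℝ) : Space d := deriv (fun w => φ w v) u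

/-- The classical partial derivative `∂_v φ (u, v)`. -/
noncomputable def dv (φ : ℝ → ℝ → Space d) (u v : ℝ) : Space d := deriv (fun z => φ u z) v

/-- The mixed derivative `∂_u ∂_v φ (u, v)`. -/
noncomputable def dudv (φ : ℝ → ℝ → Space d) (u v : ℝ) : Space d := du (dv φ) u v

/-- The mixed derivative `∂_u ∂_v φ` exists at `(u, v)`: the derivative `∂_v φ (w, v)` exists for
all `w` near `u`, and is differentiable in `w` at `u`. -/
def HasMixed (φ : ℝ → ℝ → Space d) (u v : ℝ) : Prop :=
  (∀ᶠ w in 𝓝 u, DifferentiableAt ℝ (fun z => φ w z) v) ∧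
    DifferentiableAt ℝ (fun w => dv φ w v) u

/-- Sphere-valued absolutely continuous data on `[0, a]`, that is, continuous maps
`[0, a] → S^d` of class `W^{1,1}`. -/
structure IsData (a : ℝ) (γ : ℝ → Space d) : Prop where
  mem_sphere : ∀ s ∈ Icc 0 a, γ s ∈ Metric.sphere (0 : Space d) 1
  abs_cont : AbsolutelyContinuousOnInterval γ 0 a

/-- `φ : [0, u₀] × [0, v₀] → S^d` is a wave map with boundary data `φp` (on `v = 0`) and
`φm` (on `u = 0`), in the integral sense. -/
structure IsWaveMap (u₀ v₀ : ℝ) (φp φm : ℝ → Space d) (φ : ℝ → ℝ → Space d) : Prop where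
  mem_sphere : ∀ u ∈ Icc 0 u₀, ∀ v ∈ Icc 0 v₀, φ u v ∈ Metric.sphere (0 : Space d) 1
  diff_u : ∀ᵐ p ∂(volume.restrict (rect u₀ v₀)), DifferentiableAt ℝ (fun w => φ w p.2) p.1
  diff_v : ∀ᵐ p ∂(volume.restrict (rect u₀ v₀)), DifferentiableAt ℝ (fun z => φ p.1 z) p.2
  integrable_inner :
    IntegrableOn (fun p : ℝ × ℝ => inner ℝ (du φ p.1 p.2) (dv φ p.1 p.2)) (rect u₀ v₀)
  /-- The integrand of the double integral below is a Lebesgue integrable function. Since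
  `|φ| = 1`, this adds only measurability to the previous condition. -/
  integrable_source :
    IntegrableOn (fun p : ℝ × ℝ => inner ℝ (du φ p.1 p.2) (dv φ p.1 p.2) • φ p.1 p.2)
      (rect u₀ v₀)
  duhamel : ∀ u ∈ Icc 0 u₀, ∀ v ∈ Icc 0 v₀,
    φ u v = φp u + φm v - φp 0 -
      ∫ w in (0 : ℝ)..u, ∫ z in (0 : ℝ)..v, inner ℝ (du φ w z) (dv φ w z) • φ w z

end WaveMap

/-! In characteristic form the unknown is the source `f = ⟨U, V⟩ P` in L¹ of the plane. The data
derivatives `a`, `b` are extended by zero; `U = a(u) - ∫ f dz` and `V = b(v) - ∫ f dw` are the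
slopes of the map `P`, whose mixed derivative is `-f`. Fubini's theorem and Lebesgue differentiation
translate between this system and the integral equation on the rectangle.

The decisive fact is a conservation law. If `|P| = 1`, then `U ⟂ P`; since `f` is parallel to `P`,
`∂_v |U|² = -2⟨f, U⟩ = 0`. Hence `|U(u, v)| = |a(u)|`, and likewise `|V(u, v)| = |b(v)|`
(`IsSolution.ae_norm_uSlope`). This gives (iii), and it tames the cubic nonlinearity: the difference
of two sources obeys a linear Volterra inequality with kernels `α(u)`, `β(v)`, integrable functions
made from the data. In L¹ with weight `exp(-k ∫ α - k ∫ β)` each such integration gains a factor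
`1/k`, so for `k = 16` the operators contract without any smallness of the data
(`lintegral_planeWeight_contraction`). Lipschitz dependence on the data follows
(`IsSolution.lintegral_enorm_sub_le`), hence uniqueness and (ii).

For existence these bounds are not known in advance. So `U`, `V`, `P` are retracted in the source
onto the balls of radius `|a|`, `|b|`, `1`, and Banach's theorem yields a fixed point
(`exists_eq_clippedSource`). The retracted source is still parallel to `P`; therefore the excess of
`|U|` over `|a|` and the defect of `|P|² = 1` are bounded by integrals of `⟨U, P⟩`, while `∂_v ⟨U,
P⟩` is bounded by these same defects and their mirror images. Their weighted sum obeys a homogeneous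
Volterra inequality and vanishes (`IsClippedSolution.ae_defect_eq_zero`), so the retractions change
nothing. -/

open scoped ENNReal

namespace WaveMap

/-! ### One-variable calculus for primitives of integrable functions -/

section Calculus

variable {F : Type*} [NormedAddCommGroup F] [NormedSpace ℝ F]

theorem absolutelyContinuous_of_dist_le {X Y : Type*} [PseudoMetricSpace X] [PseudoMetricSpace Y]
    {f : ℝ → X} {g : ℝ → Y} {a b : ℝ} (hf : AbsolutelyContinuousOnInterval f a b)
    (h : ∀ x ∈ uIcc a b, ∀ y ∈ uIcc a b, dist (g x) (g y) ≤ dist (f x) (f y)) :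
    AbsolutelyContinuousOnInterval g a b := by
  unfold AbsolutelyContinuousOnInterval at hf ⊢
  refine squeeze_zero' (Eventually.of_forall fun E => Finset.sum_nonneg fun _ _ => dist_nonneg)
    ?_ hf
  refine eventually_inf_principal.2 (Eventually.of_forall fun E hE => ?_)
  refine Finset.sum_le_sum fun i hi => ?_
  exact h _ (hE.1 i hi).1 _ (hE.1 i hi).2

/-- The fundamental theorem of calculus for functions whose increments are dominated by the
integral of an integrable function. -/
theorem sub_eq_integral_of_dist_le [CompleteSpace F] {h h' : ℝ → F} {k : ℝ → ℝ}
    (hk : Integrable k) (hh' : Integrable h') (hd : ∀ᵐ x, HasDerivAt h (h' x) x)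
    (hle : ∀ x y, x ≤ y → dist (h x) (h y) ≤ ∫ t in x..y, k t) (x y : ℝ) :
    h y - h x = ∫ t in x..y, h' t := by
  -- The error `N` is absolutely continuous, being dominated by the primitive of `k + ‖h'‖`, and its
  -- derivative is zero almost everywhere; hence it is constant.
  set N : ℝ → F := fun s => h s - ∫ t in x..s, h' t with hN
  have hkk : Integrable (fun t => k t + ‖h' t‖) := hk.add hh'.norm
  have hH : AbsolutelyContinuousOnInterval (fun s => ∫ t in x..s, (k t + ‖h' t‖)) x y :=
    IntervalIntegrable.absolutelyContinuousOnInterval_intervalIntegral hkk.intervalIntegrable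
      left_mem_uIcc
  have key : ∀ s t, s ≤ t → dist (N s) (N t) ≤
      dist (∫ r in x..s, (k r + ‖h' r‖)) (∫ r in x..t, (k r + ‖h' r‖)) := by
    intro s t hst
    have e1 : (∫ r in x..t, (k r + ‖h' r‖)) - ∫ r in x..s, (k r + ‖h' r‖)
        = (∫ r in s..t, k r) + ∫ r in s..t, ‖h' r‖ := by
      rw [intervalIntegral.integral_interval_sub_left hkk.intervalIntegrable
        hkk.intervalIntegrable, intervalIntegral.integral_add hk.intervalIntegrable
        hh'.norm.intervalIntegrable]
    have e2 : N t - N s = (h t - h s) - ∫ r in s..t, h' r := by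
      have := intervalIntegral.integral_interval_sub_left (μ := volume)
        (hh'.intervalIntegrable (a := x) (b := t)) (hh'.intervalIntegrable (a := x) (b := s))
      rw [← this]; simp only [hN]; abel
    rw [dist_comm (N s), dist_eq_norm, e2, dist_comm (∫ r in x..s, _), Real.dist_eq, e1]
    refine (norm_sub_le _ _).trans (le_trans ?_ (le_abs_self _))
    gcongr
    · rw [← dist_eq_norm, dist_comm]; exact hle s t hst
    · exact intervalIntegral.norm_integral_le_integral_norm hst
  have hAC : AbsolutelyContinuousOnInterval N x y := by
    refine absolutelyContinuous_of_dist_le hH fun s _ t _ => ?_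
    rcases le_total s t with hst | hst
    · exact key s t hst
    · rw [dist_comm, dist_comm (∫ r in x..s, _)]; exact key t s hst
  obtain ⟨C, hC⟩ := hAC.const_of_ae_hasDerivAt_zero (by
    filter_upwards [hd, LocallyIntegrable.ae_hasDerivAt_integral hh'.locallyIntegrable] with s h1 h2 _
    exact (h1.sub (h2 x)).congr_deriv (sub_self _))
  have h1 := hC x left_mem_uIcc
  have h2 := hC y right_mem_uIcc
  simp only [hN, intervalIntegral.integral_same, sub_zero] at h1 h2
  rw [h1, ← h2]; abel

theorem integral_Iic_eq_add {f : ℝ → F} (hf : Integrable f) (s t : ℝ) :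
    ∫ x in Iic t, f x = (∫ x in Iic s, f x) + ∫ x in s..t, f x := by
  rw [← intervalIntegral.integral_Iic_sub_Iic hf.integrableOn hf.integrableOn]; abel

theorem continuous_integral_Iic {f : ℝ → F} (hf : Integrable f) :
    Continuous fun v => ∫ t in Iic v, f t := by
  have : (fun v => ∫ t in Iic v, f t) = fun v => (∫ t in Iic 0, f t) + ∫ t in (0 : ℝ)..v, f t := by
    ext v; exact integral_Iic_eq_add hf 0 v
  rw [this]
  exact continuous_const.add
    (intervalIntegral.continuous_primitive (fun _ _ => hf.intervalIntegrable) _)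

theorem ae_hasDerivAt_integral_Iic [CompleteSpace F] {f : ℝ → F} (hf : Integrable f) :
    ∀ᵐ x, HasDerivAt (fun v => ∫ t in Iic v, f t) (f x) x := by
  have : (fun v => ∫ t in Iic v, f t) = fun v => (∫ t in Iic 0, f t) + ∫ t in (0 : ℝ)..v, f t := by
    ext v; exact integral_Iic_eq_add hf 0 v
  rw [this]
  filter_upwards [LocallyIntegrable.ae_hasDerivAt_integral hf.locallyIntegrable] with x hx
  exact (hx 0).const_add _

theorem norm_integral_Iic_le {f : ℝ → F} (hf : Integrable f) (v : ℝ) :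
    ‖∫ t in Iic v, f t‖ ≤ ∫ t, ‖f t‖ :=
  (norm_integral_le_integral_norm _).trans
    (setIntegral_le_integral hf.norm (Eventually.of_forall fun _ => norm_nonneg _))

theorem dist_integral_Iic_le {f : ℝ → F} (hf : Integrable f) {x y : ℝ} (hxy : x ≤ y) :
    dist (∫ t in Iic x, f t) (∫ t in Iic y, f t) ≤ ∫ t in x..y, ‖f t‖ := by
  rw [dist_comm, dist_eq_norm, intervalIntegral.integral_Iic_sub_Iic hf.integrableOn
    hf.integrableOn]
  exact intervalIntegral.norm_integral_le_integral_norm hxy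

/-- The fundamental theorem of calculus on a half-line. -/
theorem eq_add_integral_Iic_of_dist_le [CompleteSpace F] {h h' : ℝ → F} {k : ℝ → ℝ} {l : F}
    (hk : Integrable k) (hh' : Integrable h') (hd : ∀ᵐ x, HasDerivAt h (h' x) x)
    (hle : ∀ x y, x ≤ y → dist (h x) (h y) ≤ ∫ t in x..y, k t)
    (hl : Tendsto h atBot (𝓝 l)) (y : ℝ) :
    h y = l + ∫ t in Iic y, h' t := by
  have h1 : Tendsto (fun x => h y - h x) atBot (𝓝 (h y - l)) := tendsto_const_nhds.sub hl
  have h2 : Tendsto (fun x => ∫ t in x..y, h' t) atBot (𝓝 (∫ t in Iic y, h' t)) :=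
    intervalIntegral_tendsto_integral_Iic y hh'.integrableOn tendsto_id
  have h3 := tendsto_nhds_unique (h1.congr' ?_) h2
  · rw [← h3]; abel
  · filter_upwards with x
    exact sub_eq_integral_of_dist_le hk hh' hd hle x y

theorem tendsto_integral_Iic_atBot {f : ℝ → F} (hf : Integrable f) :
    Tendsto (fun v => ∫ t in Iic v, f t) atBot (𝓝 0) := by
  have h2 : Tendsto (fun x => ∫ t in x..0, f t) atBot (𝓝 (∫ t in Iic 0, f t)) :=
    intervalIntegral_tendsto_integral_Iic 0 hf.integrableOn tendsto_id
  have h3 : (fun v => ∫ t in Iic v, f t) = fun v => (∫ t in Iic 0, f t) - ∫ t in v..0, f t := by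
    ext v
    rw [← intervalIntegral.integral_Iic_sub_Iic hf.integrableOn hf.integrableOn]; abel
  rw [h3]
  simpa using (tendsto_const_nhds (x := ∫ t in Iic 0, f t)).sub h2

end Calculus

/-! ### Product rule for inner products of primitives -/

section Inner

variable {E : Type*} [NormedAddCommGroup E] [InnerProductSpace ℝ E]

theorem integrable_inner_of_bdd {f g : ℝ → E} (hf : Integrable f) (hg : Continuous g) {M : ℝ}
    (hM : ∀ x, ‖g x‖ ≤ M) : Integrable fun x => inner ℝ (f x) (g x) := by
  refine Integrable.mono' (hf.norm.mul_const M) (hf.1.inner hg.aestronglyMeasurable)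
    (Eventually.of_forall fun x => ?_)
  exact (norm_inner_le_norm _ _).trans (by gcongr; exact hM x)

/-- Integration by parts for the inner product of two primitives of integrable functions. -/
theorem inner_primitive [CompleteSpace E] {f g : ℝ → E} (hf : Integrable f) (hg : Integrable g) (c c' : E) (v : ℝ) :
    inner ℝ (c + ∫ x in Iic v, f x) (c' + ∫ x in Iic v, g x) = inner ℝ c c' +
      ∫ y in Iic v, (inner ℝ (f y) (c' + ∫ x in Iic y, g x) +
        inner ℝ (g y) (c + ∫ x in Iic y, f x)) := by
  set Φ : ℝ → E := fun v => c + ∫ x in Iic v, f x with hΦ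
  set Γ : ℝ → E := fun v => c' + ∫ x in Iic v, g x with hΓ
  have cΦ : Continuous Φ := continuous_const.add (continuous_integral_Iic hf)
  have cΓ : Continuous Γ := continuous_const.add (continuous_integral_Iic hg)
  -- A common bound for both primitives: it dominates the increments of their inner product by the
  -- integral of `M ‖f‖ + M ‖g‖`.
  set M : ℝ := ‖c‖ + (∫ x, ‖f x‖) + (‖c'‖ + ∫ x, ‖g x‖) with hM
  have bΦ0 : ∀ v, ‖Φ v‖ ≤ ‖c‖ + (∫ x, ‖f x‖) := fun v =>
    (norm_add_le _ _).trans (by gcongr; exact norm_integral_Iic_le hf v)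
  have bΓ0 : ∀ v, ‖Γ v‖ ≤ ‖c'‖ + (∫ x, ‖g x‖) := fun v =>
    (norm_add_le _ _).trans (by gcongr; exact norm_integral_Iic_le hg v)
  have bΦ : ∀ v, ‖Φ v‖ ≤ M := fun v =>
    (bΦ0 v).trans (le_add_of_nonneg_right ((norm_nonneg _).trans (bΓ0 0)))
  have bΓ : ∀ v, ‖Γ v‖ ≤ M := fun v =>
    (bΓ0 v).trans (le_add_of_nonneg_left ((norm_nonneg _).trans (bΦ0 0)))
  have i1 := integrable_inner_of_bdd hf cΓ bΓ
  have i2 := integrable_inner_of_bdd hg cΦ bΦ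
  refine eq_add_integral_Iic_of_dist_le (h := fun v => inner ℝ (Φ v) (Γ v))
    (k := fun t => M * ‖f t‖ + M * ‖g t‖)
    ((hf.norm.const_mul M).add (hg.norm.const_mul M)) (i1.add i2) ?_ ?_ ?_ v
  · filter_upwards [ae_hasDerivAt_integral_Iic hf, ae_hasDerivAt_integral_Iic hg] with x h1 h2
    have := (h1.const_add c).inner ℝ (h2.const_add c')
    refine this.congr_deriv ?_
    rw [add_comm]
    exact congrArg (inner ℝ (f x) (Γ x) + ·) (real_inner_comm (g x) (Φ x))
  · intro x y hxy
    rw [intervalIntegral.integral_add (hf.norm.const_mul M).intervalIntegrable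
      (hg.norm.const_mul M).intervalIntegrable, intervalIntegral.integral_const_mul,
      intervalIntegral.integral_const_mul]
    have e : inner ℝ (Φ x) (Γ x) - inner ℝ (Φ y) (Γ y) =
        inner ℝ (Φ x - Φ y) (Γ x) + inner ℝ (Φ y) (Γ x - Γ y) := by
      rw [inner_sub_left, inner_sub_right]; ring
    have d1 : ‖Φ x - Φ y‖ ≤ ∫ t in x..y, ‖f t‖ := by
      simpa [hΦ, dist_eq_norm] using dist_integral_Iic_le hf hxy
    have d2 : ‖Γ x - Γ y‖ ≤ ∫ t in x..y, ‖g t‖ := by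
      simpa [hΓ, dist_eq_norm] using dist_integral_Iic_le hg hxy
    have hM0 : 0 ≤ M := (norm_nonneg _).trans (bΦ 0)
    rw [Real.dist_eq, e]
    refine (abs_add_le _ _).trans (add_le_add ?_ ?_)
    · refine (abs_real_inner_le_norm _ _).trans ?_
      rw [mul_comm]
      exact mul_le_mul (bΓ x) d1 (norm_nonneg _) hM0
    · refine (abs_real_inner_le_norm _ _).trans ?_
      exact mul_le_mul (bΦ y) d2 (norm_nonneg _) hM0
  · have h1 : Tendsto Φ atBot (𝓝 c) := by
      simpa using tendsto_const_nhds.add (tendsto_integral_Iic_atBot hf)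
    have h2 : Tendsto Γ atBot (𝓝 c') := by
      simpa using tendsto_const_nhds.add (tendsto_integral_Iic_atBot hg)
    exact h1.inner h2

end Inner

/-! ### Exponential weights on the line -/

section Weight

/-- The weight `exp (-∫_{-∞}^v β)`. -/
noncomputable def weight (β : ℝ → ℝ≥0∞) (v : ℝ) : ℝ≥0∞ :=
  ENNReal.ofReal (Real.exp (-∫ x in Iic v, (β x).toReal))

variable {β : ℝ → ℝ≥0∞}

theorem weight_le_one (β : ℝ → ℝ≥0∞) (v : ℝ) : weight β v ≤ 1 := by
  rw [weight, ENNReal.ofReal_le_one, Real.exp_le_one_iff, neg_nonpos]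
  exact integral_nonneg fun _ => ENNReal.toReal_nonneg

theorem continuous_weight (hβ : Measurable β) (hβ' : ∫⁻ x, β x ≠ ∞) : Continuous (weight β) :=
  ENNReal.continuous_ofReal.comp (Real.continuous_exp.comp
    (continuous_integral_Iic (integrable_toReal_of_lintegral_ne_top hβ.aemeasurable hβ')).neg)

theorem exp_le_weight (hβ : Measurable β) (hβ' : ∫⁻ x, β x ≠ ∞) (v : ℝ) :
    ENNReal.ofReal (Real.exp (-(∫⁻ x, β x).toReal)) ≤ weight β v := by
  refine ENNReal.ofReal_le_ofReal (Real.exp_le_exp.2 (neg_le_neg ?_))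
  rw [← integral_toReal hβ.aemeasurable (ae_lt_top hβ hβ')]
  exact setIntegral_le_integral (integrable_toReal_of_lintegral_ne_top hβ.aemeasurable hβ')
    (Eventually.of_forall fun _ => ENNReal.toReal_nonneg)

/-- With `B` the primitive of `β`, the integrand is the derivative of `-exp (-B)`, so the integral
is `exp (-B(z)) - exp (-B(∞))`. -/
theorem lintegral_Ioi_weight_le (hβ : Measurable β) (hβ' : ∫⁻ x, β x ≠ ∞) (z : ℝ) :
    ∫⁻ x in Ioi z, weight β x * β x ≤ weight β z := by
  set r : ℝ → ℝ := fun x => (β x).toReal with hr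
  have ir : Integrable r := integrable_toReal_of_lintegral_ne_top hβ.aemeasurable hβ'
  have r0 : ∀ x, 0 ≤ r x := fun _ => ENNReal.toReal_nonneg
  set y : ℝ → ℝ := fun v => Real.exp (-∫ x in Iic v, r x) with hy
  have cy : Continuous y := Real.continuous_exp.comp (continuous_integral_Iic ir).neg
  have y0 : ∀ x, 0 ≤ y x := fun x => (Real.exp_pos _).le
  have y1 : ∀ x, y x ≤ 1 := fun x => by
    rw [hy]; simp only [Real.exp_le_one_iff, neg_nonpos]
    exact integral_nonneg r0
  have iyr : Integrable fun x => y x * r x := by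
    refine Integrable.mono' ir (cy.aestronglyMeasurable.mul ir.1) (Eventually.of_forall fun x => ?_)
    rw [Real.norm_of_nonneg (mul_nonneg (y0 x) (r0 x))]
    exact mul_le_of_le_one_left (r0 x) (y1 x)
  have hB : ∀ s t, s ≤ t → (∫ x in Iic s, r x) ≤ ∫ x in Iic t, r x := fun s t hst =>
    setIntegral_mono_set ir.integrableOn (Eventually.of_forall r0) (Iic_subset_Iic.2 hst).eventuallyLE
  have ftc : ∀ V, y V - y z = ∫ t in z..V, -(y t * r t) := fun V => by
    refine sub_eq_integral_of_dist_le (k := r) ir iyr.neg ?_ ?_ z V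
    · filter_upwards [ae_hasDerivAt_integral_Iic ir] with x hx
      refine hx.neg.exp.congr_deriv ?_
      simp [hy]
    · intro s t hst
      have d := dist_integral_Iic_le ir hst
      have hn : (fun x => ‖r x‖) = r := funext fun x => Real.norm_of_nonneg (r0 x)
      rw [hn] at d
      refine le_trans ?_ d
      rw [Real.dist_eq, Real.dist_eq, abs_of_nonneg (sub_nonneg.2 (Real.exp_le_exp.2
        (neg_le_neg (hB s t hst)))), abs_of_nonpos (sub_nonpos.2 (hB s t hst))]
      -- From `1 - x ≤ exp (-x)` with `x = B(t) - B(s)`, and `y ≤ 1`: the increments of `exp (-B)`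
      -- do not exceed those of `B`.
      have h1 := Real.add_one_le_exp (-((∫ x in Iic t, r x) - ∫ x in Iic s, r x))
      have h2 : y t = y s * Real.exp (-((∫ x in Iic t, r x) - ∫ x in Iic s, r x)) := by
        simp only [hy]; rw [← Real.exp_add]; ring_nf
      change y s - y t ≤ _
      rw [h2]
      nlinarith [y0 s, y1 s, hB s t hst]
  have hle : ∫ x in Ioi z, y x * r x ≤ y z := by
    refine le_of_tendsto (intervalIntegral_tendsto_integral_Ioi z iyr.integrableOn tendsto_id) ?_
    filter_upwards with V
    have := ftc V
    rw [intervalIntegral.integral_neg] at this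
    simp only [id]
    linarith [y0 V]
  calc ∫⁻ x in Ioi z, weight β x * β x = ∫⁻ x in Ioi z, ENNReal.ofReal (y x * r x) := by
        refine lintegral_congr_ae (ae_restrict_of_ae ?_)
        filter_upwards [ae_lt_top hβ hβ'] with x hx
        rw [ENNReal.ofReal_mul (y0 x), hr, ENNReal.ofReal_toReal hx.ne]; rfl
    _ = ENNReal.ofReal (∫ x in Ioi z, y x * r x) :=
        (ofReal_integral_eq_lintegral_ofReal iyr.integrableOn
          (Eventually.of_forall fun x => mul_nonneg (y0 x) (r0 x))).symm
    _ ≤ weight β z := ENNReal.ofReal_le_ofReal hle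

/-- Tonelli exchanges the integrals, and the tail integral of `weight β * β` is absorbed by the
weight. Applied to `k β`, this yields the gain `1/k`. -/
theorem lintegral_weight_volterra_le (hβ : Measurable β) (hβ' : ∫⁻ x, β x ≠ ∞) {D : ℝ → ℝ≥0∞}
    (hD : Measurable D) :
    ∫⁻ v, weight β v * (β v * ∫⁻ z in Iic v, D z) ≤ ∫⁻ z, weight β z * D z := by
  have mw : Measurable (weight β) := (continuous_weight hβ hβ').measurable
  have mS : MeasurableSet {p : ℝ × ℝ | p.2 ≤ p.1} := measurableSet_le measurable_snd measurable_fst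
  calc ∫⁻ v, weight β v * (β v * ∫⁻ z in Iic v, D z)
      = ∫⁻ v, ∫⁻ z, {p : ℝ × ℝ | p.2 ≤ p.1}.indicator
          (fun p => weight β p.1 * β p.1 * D p.2) (v, z) := by
        refine lintegral_congr fun v => ?_
        rw [← mul_assoc, ← lintegral_const_mul _ hD, ← lintegral_indicator measurableSet_Iic]
        refine lintegral_congr fun z => ?_
        simp [indicator]
    _ = ∫⁻ z, ∫⁻ v, {p : ℝ × ℝ | p.2 ≤ p.1}.indicator
          (fun p => weight β p.1 * β p.1 * D p.2) (v, z) := by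
        refine lintegral_lintegral_swap (Measurable.aemeasurable ?_)
        exact (((mw.comp measurable_fst).mul (hβ.comp measurable_fst)).mul
          (hD.comp measurable_snd)).indicator mS
    _ = ∫⁻ z, (∫⁻ v in Ioi z, weight β v * β v) * D z := by
        refine lintegral_congr fun z => ?_
        rw [← lintegral_mul_const (μ := volume.restrict (Ioi z)) (D z) (f := fun v => weight β v * β v)
          (mw.mul hβ), setLIntegral_congr Ioi_ae_eq_Ici,
          ← lintegral_indicator measurableSet_Ici]
        refine lintegral_congr fun v => ?_
        simp [indicator]
    _ ≤ ∫⁻ z, weight β z * D z := by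
        refine lintegral_mono fun z => ?_
        gcongr
        exact lintegral_Ioi_weight_le hβ hβ' z

end Weight

/-! ### Double integrals over quadrants and their derivatives -/

section Plane

variable {F : Type*} [NormedAddCommGroup F]

theorem ae_integrable_section {f : ℝ × ℝ → F} (hf : Integrable f) :
    ∀ᵐ u, Integrable fun z => f (u, z) := by
  rw [Measure.volume_eq_prod] at hf
  exact hf.prod_right_ae

theorem integrable_comp_swap {f : ℝ × ℝ → F} (hf : Integrable f) :
    Integrable (f ∘ Prod.swap) := by
  rw [Measure.volume_eq_prod] at hf ⊢
  exact hf.swap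

variable [NormedSpace ℝ F]

theorem integrable_integral_Iic_right {f : ℝ × ℝ → F} (hf : Integrable f) (v : ℝ) :
    Integrable fun u => ∫ z in Iic v, f (u, z) := by
  have h : Integrable f (volume.prod (volume.restrict (Iic v))) := by
    refine hf.mono_measure ?_
    rw [Measure.volume_eq_prod]
    exact Measure.prod_mono le_rfl Measure.restrict_le_self
  exact h.integral_prod_left

theorem setIntegral_Iic_prod {f : ℝ × ℝ → F} (hf : Integrable f) (u v : ℝ) :
    ∫ q in Iic u ×ˢ Iic v, f q = ∫ w in Iic u, ∫ z in Iic v, f (w, z) := by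
  rw [Measure.volume_eq_prod] at hf ⊢
  exact setIntegral_prod f hf.integrableOn

theorem setIntegral_Iic_prod_swap (f : ℝ × ℝ → F) (u v : ℝ) :
    ∫ q in Iic v ×ˢ Iic u, (f ∘ Prod.swap) q = ∫ q in Iic u ×ˢ Iic v, f q := by
  rw [Measure.volume_eq_prod]
  exact setIntegral_prod_swap _ _ f

theorem ae_swap {p : ℝ × ℝ → Prop} (h : ∀ᵐ q, p q) : ∀ᵐ q : ℝ × ℝ, p q.swap := by
  rw [Measure.volume_eq_prod] at h ⊢
  exact Measure.measurePreserving_swap.quasiMeasurePreserving.ae h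

theorem ae_prod_of_ae_fst {p : ℝ → Prop} (h : ∀ᵐ u, p u) : ∀ᵐ q : ℝ × ℝ, p q.1 := by
  rw [Measure.volume_eq_prod]
  exact Measure.quasiMeasurePreserving_fst.ae h

theorem ae_prod_of_ae_snd {p : ℝ → Prop} (h : ∀ᵐ u, p u) : ∀ᵐ q : ℝ × ℝ, p q.2 := by
  rw [Measure.volume_eq_prod]
  exact Measure.quasiMeasurePreserving_snd.ae h

theorem ae_ae_of_ae {p : ℝ × ℝ → Prop} (h : ∀ᵐ q, p q) : ∀ᵐ u, ∀ᵐ v, p (u, v) := by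
  rw [Measure.volume_eq_prod] at h
  exact Measure.ae_ae_of_ae_prod h

/-- For almost every `u`, the double integral `∫_{-∞}^u ∫_{-∞}^v f` is differentiable in `u`
for all `v` simultaneously. -/
theorem ae_forall_hasDerivAt_setIntegral [CompleteSpace F] {f : ℝ × ℝ → F} (hf : Integrable f) :
    ∀ᵐ u, ∀ v, HasDerivAt (fun w => ∫ q in Iic w ×ˢ Iic v, f q) (∫ z in Iic v, f (u, z)) u := by
  set G : ℝ → ℝ → F := fun r x => ∫ z in Iic r, f (x, z) with hG
  set N : ℝ → ℝ → ℝ := fun r x => ∫ z in Iic r, ‖f (x, z)‖ with hN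
  have iG : ∀ r, Integrable (G r) := integrable_integral_Iic_right hf
  have iN : ∀ r, Integrable (N r) := integrable_integral_Iic_right hf.norm
  simp_rw [setIntegral_Iic_prod hf]
  -- Each value of the second variable has its own null set, so only countably many values can be
  -- treated at once. The others are squeezed between rationals.
  have h1 : ∀ᵐ u, ∀ r : ℚ, HasDerivAt (fun w => ∫ x in Iic w, G r x) (G r u) u :=
    ae_all_iff.2 fun r => ae_hasDerivAt_integral_Iic (iG r)
  have h2 : ∀ᵐ u, ∀ r : ℚ, HasDerivAt (fun w => ∫ x in Iic w, N r x) (N r u) u :=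
    ae_all_iff.2 fun r => ae_hasDerivAt_integral_Iic (iN r)
  -- Moving from `r` to `v` changes the inner integral by at most the mass of `‖f (u, ·)‖` between
  -- `r` and `s`, a quantity that involves only the end points.
  have hGN : ∀ u, Integrable (fun z => f (u, z)) → ∀ r v s, r ≤ v → v ≤ s →
      ‖G v u - G r u‖ ≤ N s u - N r u := by
    intro u hu r v s hrv hvs
    have e1 : G v u - G r u = ∫ z in r..v, f (u, z) :=
      intervalIntegral.integral_Iic_sub_Iic hu.integrableOn hu.integrableOn
    have e2 : N s u - N r u = ∫ z in r..s, ‖f (u, z)‖ :=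
      intervalIntegral.integral_Iic_sub_Iic hu.norm.integrableOn hu.norm.integrableOn
    rw [e1, e2]
    refine (intervalIntegral.norm_integral_le_integral_norm hrv).trans ?_
    exact intervalIntegral.integral_mono_interval le_rfl hrv hvs
      (Eventually.of_forall fun _ => norm_nonneg _) hu.norm.intervalIntegrable
  filter_upwards [h1, h2, ae_integrable_section hf] with u h1 h2 hu v
  rw [hasDerivAt_iff_isLittleO, Asymptotics.isLittleO_iff]
  intro ε hε
  have cN : ContinuousAt (fun r => N r u) v := (continuous_integral_Iic hu.norm).continuousAt
  obtain ⟨δ, hδ, hδN⟩ := Metric.continuousAt_iff.1 cN (ε / 8) (by positivity)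
  obtain ⟨r, hr1, hr2⟩ := exists_rat_btwn (show v - δ < v by linarith)
  obtain ⟨s, hs1, hs2⟩ := exists_rat_btwn (show v < v + δ by linarith)
  have hsmall : N s u - N r u ≤ ε / 4 := by
    have a1 := hδN (x := r) (by rw [Real.dist_eq, abs_lt]; constructor <;> linarith)
    have a2 := hδN (x := s) (by rw [Real.dist_eq, abs_lt]; constructor <;> linarith)
    rw [Real.dist_eq, abs_lt] at a1 a2
    linarith
  have b1 := (Asymptotics.isLittleO_iff.1 (hasDerivAt_iff_isLittleO.1 (h1 r)))
    (show 0 < ε / 8 by positivity)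
  have b2 := (Asymptotics.isLittleO_iff.1 (hasDerivAt_iff_isLittleO.1 (h2 r)))
    (show 0 < ε / 8 by positivity)
  have b3 := (Asymptotics.isLittleO_iff.1 (hasDerivAt_iff_isLittleO.1 (h2 s)))
    (show 0 < ε / 8 by positivity)
  filter_upwards [b1, b2, b3] with w b1 b2 b3
  have I : ∀ t, (∫ x in Iic w, G t x) - ∫ x in Iic u, G t x = ∫ x in u..w, G t x := fun t =>
    intervalIntegral.integral_Iic_sub_Iic (iG t).integrableOn (iG t).integrableOn
  have J : ∀ t, (∫ x in Iic w, N t x) - ∫ x in Iic u, N t x = ∫ x in u..w, N t x := fun t =>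
    intervalIntegral.integral_Iic_sub_Iic (iN t).integrableOn (iN t).integrableOn
  rw [I] at b1 ⊢
  rw [J] at b2 b3
  have mid : ‖(∫ x in u..w, G v x) - ∫ x in u..w, G r x‖ ≤
      |(∫ x in u..w, N s x) - ∫ x in u..w, N r x| := by
    rw [← intervalIntegral.integral_sub (iG v).intervalIntegrable (iG r).intervalIntegrable,
      ← intervalIntegral.integral_sub (iN s).intervalIntegrable (iN r).intervalIntegrable]
    refine intervalIntegral.norm_integral_le_abs_of_norm_le ?_
      ((iN s).sub (iN r)).intervalIntegrable
    refine ae_restrict_of_ae ?_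
    filter_upwards [ae_integrable_section hf] with x hx
    exact hGN x hx r v s hr2.le hs1.le
  -- Three errors: differentiation at the rational `r`, the integrated change from `r` to `v`, and
  -- that change at `u`. They cost `ε/8`, `ε/2` and `ε/4` times `‖w - u‖`.
  have e : (∫ x in u..w, G v x) - (w - u) • G v u =
      ((∫ x in u..w, G r x) - (w - u) • G r u) +
      ((∫ x in u..w, G v x) - ∫ x in u..w, G r x) - (w - u) • (G v u - G r u) := by
    rw [smul_sub]; abel
  have l3 : ‖(w - u) • (G v u - G r u)‖ ≤ ‖w - u‖ * (ε / 4) := by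
    rw [norm_smul]
    gcongr
    exact (hGN u hu r v s hr2.le hs1.le).trans hsmall
  have l2 : |(∫ x in u..w, N s x) - ∫ x in u..w, N r x| ≤ ‖w - u‖ * (ε / 2) := by
    have e2 : (∫ x in u..w, N s x) - ∫ x in u..w, N r x =
        ((∫ x in u..w, N s x) - (w - u) • N s u) - ((∫ x in u..w, N r x) - (w - u) • N r u)
        + (w - u) * (N s u - N r u) := by simp only [smul_eq_mul]; ring
    have nn : 0 ≤ N s u - N r u :=
      (norm_nonneg _).trans (hGN u hu r v s hr2.le hs1.le)
    rw [e2]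
    refine (abs_add_le _ _).trans ?_
    have t1 := abs_sub ((∫ x in u..w, N s x) - (w - u) • N s u)
      ((∫ x in u..w, N r x) - (w - u) • N r u)
    have t2 : |(w - u) * (N s u - N r u)| ≤ ‖w - u‖ * (ε / 4) := by
      rw [abs_mul, abs_of_nonneg nn, Real.norm_eq_abs]
      gcongr
    rw [Real.norm_eq_abs] at b2 b3
    linarith
  rw [e]
  have t := norm_sub_le (((∫ x in u..w, G r x) - (w - u) • G r u) +
      ((∫ x in u..w, G v x) - ∫ x in u..w, G r x)) ((w - u) • (G v u - G r u))
  have t' := norm_add_le ((∫ x in u..w, G r x) - (w - u) • G r u)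
      ((∫ x in u..w, G v x) - ∫ x in u..w, G r x)
  nlinarith [norm_nonneg (w - u)]

theorem stronglyMeasurable_integral_Iic_right {f : ℝ × ℝ → F} (hf : StronglyMeasurable f) :
    StronglyMeasurable fun q : ℝ × ℝ => ∫ z in Iic q.2, f (q.1, z) := by
  have hS : MeasurableSet {p : (ℝ × ℝ) × ℝ | p.2 ≤ p.1.2} :=
    measurableSet_le measurable_snd (measurable_snd.comp measurable_fst)
  have h : StronglyMeasurable (fun p : (ℝ × ℝ) × ℝ =>
      {p : (ℝ × ℝ) × ℝ | p.2 ≤ p.1.2}.indicator (fun p => f (p.1.1, p.2)) p) :=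
    (hf.comp_measurable ((measurable_fst.comp measurable_fst).prodMk measurable_snd)).indicator hS
  have := h.integral_prod_right' (ν := (volume : Measure ℝ))
  convert this using 2 with q
  rw [← integral_indicator measurableSet_Iic]
  rfl

theorem stronglyMeasurable_integral_Iic_left {f : ℝ × ℝ → F} (hf : StronglyMeasurable f) :
    StronglyMeasurable fun q : ℝ × ℝ => ∫ w in Iic q.1, f (w, q.2) :=
  (stronglyMeasurable_integral_Iic_right (hf.comp_measurable measurable_swap)).comp_measurable
    measurable_swap

/-- For continuous `k` the bound on the difference quotient is a closed condition on the increment,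
so rational increments suffice. Differentiability becomes a countable, hence measurable, condition.
-/
theorem hasDerivAt_iff_forall_rat {k : ℝ → F} (hk : Continuous k) (l : F) (u : ℝ) :
    HasDerivAt k l u ↔ ∀ n : ℕ, ∃ m : ℕ, ∀ h : ℚ, |(h : ℝ)| < 1 / (m + 1) →
      ‖k (u + h) - k u - (h : ℝ) • l‖ ≤ 1 / (n + 1) * |(h : ℝ)| := by
  rw [hasDerivAt_iff_isLittleO_nhds_zero, Asymptotics.isLittleO_iff]
  constructor
  · intro H n
    obtain ⟨δ, hδ, hH⟩ := Metric.eventually_nhds_iff.1 (H (c := 1 / (n + 1)) (by positivity))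
    obtain ⟨m, hm⟩ := exists_nat_one_div_lt hδ
    exact ⟨m, fun h hh => hH (by rw [dist_zero_right, Real.norm_eq_abs]; exact hh.trans hm)⟩
  · intro H c hc
    obtain ⟨n, hn⟩ := exists_nat_one_div_lt hc
    obtain ⟨m, hm⟩ := H n
    refine Metric.eventually_nhds_iff.2 ⟨1 / (m + 1), by positivity, fun y hy => ?_⟩
    have hy' : |y| < 1 / (m + 1) := by simpa using hy
    have hcl : y ∈ closure (Metric.ball (0 : ℝ) (1 / (m + 1)) ∩ range ((↑) : ℚ → ℝ)) := by
      refine (Rat.isDenseEmbedding_coe_real.dense.open_subset_closure_inter Metric.isOpen_ball) ?_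
      simpa using hy'
    have hclosed : IsClosed {y : ℝ | ‖k (u + y) - k u - y • l‖ ≤ c * ‖y‖} :=
      isClosed_le (by fun_prop) (by fun_prop)
    refine closure_minimal ?_ hclosed hcl
    rintro _ ⟨hb, ⟨h, rfl⟩⟩
    refine (hm h (by rwa [mem_ball_zero_iff, Real.norm_eq_abs] at hb)).trans ?_
    rw [Real.norm_eq_abs]
    gcongr

/-- On each line of constant second variable this is Lebesgue differentiation; Fubini assembles the
lines, since the good set is measurable. It provides the mixed derivative. -/
theorem ae_hasDerivAt_section [CompleteSpace F] {f : ℝ × ℝ → F} (hf : Integrable f)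
    (hm : StronglyMeasurable f) :
    ∀ᵐ q : ℝ × ℝ, HasDerivAt (fun w => ∫ x in Iic w, f (x, q.2)) (f q) q.1 := by
  set K : ℝ × ℝ → F := fun q => ∫ x in Iic q.1, f (x, q.2) with hK
  have mK : StronglyMeasurable K := stronglyMeasurable_integral_Iic_left hm
  set S : Set (ℝ × ℝ) := {q | ∀ n : ℕ, ∃ m : ℕ, ∀ h : ℚ, |(h : ℝ)| < 1 / (m + 1) →
      ‖K (q.1 + h, q.2) - K (q.1, q.2) - (h : ℝ) • f q‖ ≤ 1 / (n + 1) * |(h : ℝ)|} with hS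
  have mS : MeasurableSet S := by
    simp only [hS, ofPred_forall, ofPred_exists]
    refine MeasurableSet.iInter fun n => MeasurableSet.iUnion fun m => MeasurableSet.iInter
      fun h => MeasurableSet.iInter fun _ => ?_
    refine measurableSet_le (StronglyMeasurable.measurable ?_) measurable_const
    refine StronglyMeasurable.norm ?_
    refine ((mK.comp_measurable ?_).sub (mK.comp_measurable ?_)).sub (hm.const_smul _)
    · exact (measurable_fst.add_const _).prodMk measurable_snd
    · exact measurable_fst.prodMk measurable_snd
  have hsec : ∀ᵐ v, Integrable fun w => f (w, v) :=
    ae_integrable_section (integrable_comp_swap hf)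
  have hae : ∀ᵐ q : ℝ × ℝ, q.swap ∈ S := by
    rw [Measure.volume_eq_prod]
    refine (Measure.ae_prod_mem_iff_ae_ae_mem (s := Prod.swap ⁻¹' S) (measurable_swap mS)).2 ?_
    filter_upwards [hsec] with v hv
    filter_upwards [ae_hasDerivAt_integral_Iic hv] with u hu
    exact (hasDerivAt_iff_forall_rat (continuous_integral_Iic hv) _ _).1 hu
  filter_upwards [ae_swap hae, ae_prod_of_ae_snd hsec] with q hq hv
  rw [Prod.swap_swap] at hq
  exact (hasDerivAt_iff_forall_rat (continuous_integral_Iic hv) _ _).2 hq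

end Plane

/-! ### The first order system and its conservation law -/

section System

variable {E : Type*} [NormedAddCommGroup E] [InnerProductSpace ℝ E]

/-- The `u`-derivative `a(u) - ∫_{-∞}^v f(u, z) dz` of the function with characteristic data `a`
and mixed derivative `-f`. -/
noncomputable def uSlope (a : ℝ → E) (f : ℝ × ℝ → E) (u v : ℝ) : E :=
  a u - ∫ z in Iic v, f (u, z)

/-- The `v`-derivative `b(v) - ∫_{-∞}^u f(w, v) dw`. -/
noncomputable def vSlope (b : ℝ → E) (f : ℝ × ℝ → E) (u v : ℝ) : E :=
  b v - ∫ w in Iic u, f (w, v)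

/-- The function with value `c` at `-∞`, characteristic data with derivatives `a`, `b`, and mixed
derivative `-f`. -/
noncomputable def wave (c : E) (a b : ℝ → E) (f : ℝ × ℝ → E) (u v : ℝ) : E :=
  c + (∫ w in Iic u, a w) + (∫ z in Iic v, b z) - ∫ q in Iic u ×ˢ Iic v, f q

/-- The symmetry exchanging `u` and `v`, by which each estimate for one slope yields that for the
other. -/
theorem uSlope_swap (a : ℝ → E) (f : ℝ × ℝ → E) (u v : ℝ) :
    uSlope a (f ∘ Prod.swap) u v = vSlope a f v u := rfl

theorem vSlope_swap (b : ℝ → E) (f : ℝ × ℝ → E) (u v : ℝ) :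
    vSlope b (f ∘ Prod.swap) u v = uSlope b f v u := rfl

theorem wave_swap (c : E) (a b : ℝ → E) (f : ℝ × ℝ → E) (u v : ℝ) :
    wave c a b (f ∘ Prod.swap) u v = wave c b a f v u := by
  rw [wave, wave, setIntegral_Iic_prod_swap]; abel

variable {c : E} {a b : ℝ → E} {f : ℝ × ℝ → E}

theorem integrable_uSlope (ha : Integrable a) (hf : Integrable f) (v : ℝ) :
    Integrable fun u => uSlope a f u v :=
  ha.sub (integrable_integral_Iic_right hf v)

theorem integrable_vSlope (hb : Integrable b) (hf : Integrable f) (u : ℝ) :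
    Integrable fun v => vSlope b f u v :=
  integrable_uSlope hb (integrable_comp_swap hf) u

theorem stronglyMeasurable_uSlope (ha : StronglyMeasurable a) (hf : StronglyMeasurable f) :
    StronglyMeasurable fun q : ℝ × ℝ => uSlope a f q.1 q.2 :=
  (ha.comp_measurable measurable_fst).sub (stronglyMeasurable_integral_Iic_right hf)

theorem stronglyMeasurable_vSlope (hb : StronglyMeasurable b) (hf : StronglyMeasurable f) :
    StronglyMeasurable fun q : ℝ × ℝ => vSlope b f q.1 q.2 :=
  (hb.comp_measurable measurable_snd).sub (stronglyMeasurable_integral_Iic_left hf)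

theorem wave_eq_add_integral_uSlope (ha : Integrable a) (hf : Integrable f) (u v : ℝ) :
    wave c a b f u v = (c + ∫ z in Iic v, b z) + ∫ w in Iic u, uSlope a f w v := by
  unfold wave uSlope
  rw [integral_sub ha.integrableOn (integrable_integral_Iic_right hf v).integrableOn,
    setIntegral_Iic_prod hf]
  abel

theorem wave_eq_add_integral_vSlope (hb : Integrable b) (hf : Integrable f) (u v : ℝ) :
    wave c a b f u v = (c + ∫ w in Iic u, a w) + ∫ z in Iic v, vSlope b f u z := by
  rw [← wave_swap, wave_eq_add_integral_uSlope hb (integrable_comp_swap hf)]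
  rfl

theorem stronglyMeasurable_wave (ha : StronglyMeasurable a) (ha' : Integrable a)
    (hb' : Integrable b) (hf : StronglyMeasurable f) (hf' : Integrable f) :
    StronglyMeasurable fun q : ℝ × ℝ => wave c a b f q.1 q.2 := by
  simp_rw [wave_eq_add_integral_uSlope ha' hf']
  refine (stronglyMeasurable_const.add ?_).add ?_
  · exact (continuous_integral_Iic hb').stronglyMeasurable.comp_measurable measurable_snd
  · exact stronglyMeasurable_integral_Iic_left (f := fun q => uSlope a f q.1 q.2)
      (stronglyMeasurable_uSlope ha hf)

/-- The first order form of the wave map equation. -/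
structure IsSolution (c : E) (a b : ℝ → E) (f : ℝ × ℝ → E) : Prop where
  meas_a : StronglyMeasurable a
  meas_b : StronglyMeasurable b
  meas_f : StronglyMeasurable f
  int_a : Integrable a
  int_b : Integrable b
  int_f : Integrable f
  norm_wave : ∀ u v, ‖wave c a b f u v‖ = 1
  eq : ∀ᵐ q : ℝ × ℝ, f q =
    inner ℝ (uSlope a f q.1 q.2) (vSlope b f q.1 q.2) • wave c a b f q.1 q.2

namespace IsSolution

theorem swap (h : IsSolution c a b f) : IsSolution c b a (f ∘ Prod.swap) where
  meas_a := h.meas_b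
  meas_b := h.meas_a
  meas_f := h.meas_f.comp_measurable measurable_swap
  int_a := h.int_b
  int_b := h.int_a
  int_f := integrable_comp_swap h.int_f
  norm_wave u v := by rw [wave_swap]; exact h.norm_wave v u
  eq := by
    filter_upwards [ae_swap h.eq] with q hq
    rw [uSlope_swap, vSlope_swap, wave_swap, real_inner_comm]
    exact hq

end IsSolution

variable [CompleteSpace E]

/-- The exceptional set of `u` is independent of `v`. This allows `v` to be the edge value `v₀` and
permits integration in `v` at fixed `u`. -/
theorem ae_forall_hasDerivAt_wave (ha : Integrable a) (hf : Integrable f) :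
    ∀ᵐ u, ∀ v, HasDerivAt (fun w => wave c a b f w v) (uSlope a f u v) u := by
  filter_upwards [ae_hasDerivAt_integral_Iic ha, ae_forall_hasDerivAt_setIntegral hf] with u h1 h2 v
  exact ((h1.const_add c).add_const _).sub (h2 v)

theorem ae_forall_hasDerivAt_wave_right (hb : Integrable b) (hf : Integrable f) :
    ∀ᵐ v, ∀ u, HasDerivAt (fun z => wave c a b f u z) (vSlope b f u v) v := by
  filter_upwards [ae_forall_hasDerivAt_wave (c := c) (b := a) hb (integrable_comp_swap hf)]
    with v h u
  simpa only [wave_swap, uSlope_swap] using h u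

namespace IsSolution

/-- The `u`-derivative of `|P|² = 1`. -/
theorem ae_inner_uSlope_wave (h : IsSolution c a b f) :
    ∀ᵐ u, ∀ v, inner ℝ (uSlope a f u v) (wave c a b f u v) = 0 := by
  filter_upwards [ae_forall_hasDerivAt_wave (c := c) (b := b) h.int_a h.int_f] with u hu v
  have h1 := (hu v).inner ℝ (hu v)
  have h2 : (fun w => inner ℝ (wave c a b f w v) (wave c a b f w v)) = fun _ => (1 : ℝ) := by
    ext w; rw [real_inner_self_eq_norm_sq, h.norm_wave]; norm_num
  rw [h2] at h1
  have h3 := h1.unique (hasDerivAt_const u (1 : ℝ))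
  rw [real_inner_comm] at h3
  linarith

/-- The pointwise conservation law. -/
theorem ae_norm_uSlope (h : IsSolution c a b f) : ∀ᵐ u, ∀ v, ‖uSlope a f u v‖ = ‖a u‖ := by
  filter_upwards [h.ae_inner_uSlope_wave, ae_integrable_section h.int_f, ae_ae_of_ae h.eq]
    with u h1 h2 h3 v
  have key := inner_primitive h2.neg h2.neg (a u) (a u) v
  have e : ∀ v, a u + ∫ x in Iic v, -f (u, x) = uSlope a f u v := fun v => by
    rw [integral_neg, uSlope, sub_eq_add_neg]
  -- The integrand is `∂_v |U|² = -2⟨f, U⟩`, which vanishes because `f` is parallel to `P` and `U ⟂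
  -- P`.
  have z : ∫ y in Iic v, (inner ℝ (-f (u, y)) (a u + ∫ x in Iic y, -f (u, x)) +
        inner ℝ (-f (u, y)) (a u + ∫ x in Iic y, -f (u, x))) = 0 := by
    rw [← integral_zero ℝ ℝ (μ := volume.restrict (Iic v))]
    refine integral_congr_ae (ae_restrict_of_ae ?_)
    filter_upwards [h3] with y hy
    rw [e, hy, inner_neg_left, inner_smul_left, real_inner_comm (uSlope a f u y) (wave c a b f u y), h1 y]
    simp
  simp only [Pi.neg_apply] at key
  rw [z, e, add_zero, real_inner_self_eq_norm_sq, real_inner_self_eq_norm_sq] at key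
  exact (sq_eq_sq₀ (norm_nonneg _) (norm_nonneg _)).1 key

theorem ae_norm_vSlope (h : IsSolution c a b f) : ∀ᵐ v, ∀ u, ‖vSlope b f u v‖ = ‖b v‖ :=
  h.swap.ae_norm_uSlope

end IsSolution

end System

/-! ### Volterra operators in a weighted norm -/

section Volterra

/-- Multiplication by `β` after integration in the second variable. -/
noncomputable def vVolterra (β : ℝ → ℝ≥0∞) (D : ℝ × ℝ → ℝ≥0∞) (q : ℝ × ℝ) : ℝ≥0∞ :=
  β q.2 * ∫⁻ z in Iic q.2, D (q.1, z)

/-- Multiplication by `α` after integration in the first variable. -/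
noncomputable def uVolterra (α : ℝ → ℝ≥0∞) (D : ℝ × ℝ → ℝ≥0∞) (q : ℝ × ℝ) : ℝ≥0∞ :=
  α q.1 * ∫⁻ w in Iic q.1, D (w, q.2)

/-- The weight `exp (-k ∫_{-∞}^u α - k ∫_{-∞}^v β)`. -/
noncomputable def planeWeight (k : ℝ≥0∞) (α β : ℝ → ℝ≥0∞) (q : ℝ × ℝ) : ℝ≥0∞ :=
  weight (fun x => k * α x) q.1 * weight (fun x => k * β x) q.2

variable {k : ℝ≥0∞} {α β : ℝ → ℝ≥0∞} {D : ℝ × ℝ → ℝ≥0∞}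

theorem planeWeight_le_one (q : ℝ × ℝ) : planeWeight k α β q ≤ 1 :=
  mul_le_one' (weight_le_one _ _) (weight_le_one _ _)

theorem planeWeight_swap (q : ℝ × ℝ) : planeWeight k β α q.swap = planeWeight k α β q :=
  mul_comm _ _

theorem lintegral_const_mul_ne_top (hk : k ≠ ∞) (hα : Measurable α) (hα' : ∫⁻ x, α x ≠ ∞) :
    ∫⁻ x, k * α x ≠ ∞ := by
  rw [lintegral_const_mul _ hα]; exact ENNReal.mul_ne_top hk hα'

theorem measurable_planeWeight (hk : k ≠ ∞) (hα : Measurable α) (hα' : ∫⁻ x, α x ≠ ∞)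
    (hβ : Measurable β) (hβ' : ∫⁻ x, β x ≠ ∞) : Measurable (planeWeight k α β) :=
  ((continuous_weight (hα.const_mul k)
    (lintegral_const_mul_ne_top hk hα hα')).measurable.comp measurable_fst).mul
  ((continuous_weight (hβ.const_mul k)
    (lintegral_const_mul_ne_top hk hβ hβ')).measurable.comp measurable_snd)

/-- The lower bound depends on the data only through a bound `M` for their masses, so the weighted
and plain L¹ norms are equivalent, uniformly over bounded data. -/
theorem exp_le_planeWeight (hk : k ≠ ∞) (hα : Measurable α) (hβ : Measurable β) {M : ℝ≥0∞}
    (hM : M ≠ ∞) (hαM : ∫⁻ x, α x ≤ M) (hβM : ∫⁻ x, β x ≤ M) (q : ℝ × ℝ) :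
    ENNReal.ofReal (Real.exp (-(k * M).toReal)) * ENNReal.ofReal (Real.exp (-(k * M).toReal)) ≤
      planeWeight k α β q := by
  have key : ∀ {γ : ℝ → ℝ≥0∞}, Measurable γ → ∫⁻ x, γ x ≤ M → ∀ v,
      ENNReal.ofReal (Real.exp (-(k * M).toReal)) ≤ weight (fun x => k * γ x) v := by
    intro γ hγ hγM v
    have h := lintegral_const_mul_ne_top hk hγ (ne_top_of_le_ne_top hM hγM)
    refine le_trans (ENNReal.ofReal_le_ofReal (Real.exp_le_exp.2 (neg_le_neg ?_)))
      (exp_le_weight (hγ.const_mul k) h v)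
    refine ENNReal.toReal_mono (ENNReal.mul_ne_top hk hM) ?_
    rw [lintegral_const_mul _ hγ]
    gcongr
  exact mul_le_mul' (key hα hαM _) (key hβ hβM _)

theorem lintegral_plane_swap (g : ℝ × ℝ → ℝ≥0∞) :
    ∫⁻ q : ℝ × ℝ, g q.swap = ∫⁻ q, g q := by
  rw [Measure.volume_eq_prod]
  exact lintegral_prod_swap g

theorem measurable_vVolterra (hβ : Measurable β) (hD : Measurable D) :
    Measurable (vVolterra β D) := by
  have hS : MeasurableSet {p : (ℝ × ℝ) × ℝ | p.2 ≤ p.1.2} :=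
    measurableSet_le measurable_snd (measurable_snd.comp measurable_fst)
  have h : Measurable (fun p : (ℝ × ℝ) × ℝ =>
      {p : (ℝ × ℝ) × ℝ | p.2 ≤ p.1.2}.indicator (fun p => D (p.1.1, p.2)) p) :=
    (hD.comp ((measurable_fst.comp measurable_fst).prodMk measurable_snd)).indicator hS
  have h' := h.lintegral_prod_right' (ν := (volume : Measure ℝ))
  refine (hβ.comp measurable_snd).mul ?_
  convert h' using 2 with q
  rw [← lintegral_indicator measurableSet_Iic]
  rfl

theorem uVolterra_swap (q : ℝ × ℝ) :
    uVolterra α D q.swap = vVolterra α (D ∘ Prod.swap) q := rfl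

theorem measurable_uVolterra (hα : Measurable α) (hD : Measurable D) :
    Measurable (uVolterra α D) :=
  (measurable_vVolterra hα (hD.comp measurable_swap)).comp measurable_swap

/-- At fixed `u` the `u`-factor of the weight is a constant, and the one-variable estimate applies
with `k β` in place of `β`. -/
theorem lintegral_planeWeight_vVolterra_le (hk : k ≠ ∞) (hα : Measurable α)
    (hα' : ∫⁻ x, α x ≠ ∞) (hβ : Measurable β) (hβ' : ∫⁻ x, β x ≠ ∞) (hD : Measurable D) :
    k * ∫⁻ q, planeWeight k α β q * vVolterra β D q ≤ ∫⁻ q, planeWeight k α β q * D q := by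
  have mW := measurable_planeWeight hk hα hα' hβ hβ'
  have mV := measurable_vVolterra hβ hD
  have mWV : Measurable fun q => planeWeight k α β q * vVolterra β D q := mW.mul mV
  have mWD : Measurable fun q => planeWeight k α β q * D q := mW.mul hD
  rw [← lintegral_const_mul _ mWV, Measure.volume_eq_prod,
    lintegral_prod _ (mWV.const_mul k).aemeasurable, lintegral_prod _ mWD.aemeasurable]
  refine lintegral_mono fun u => ?_
  have hDu : Measurable fun z => D (u, z) := hD.comp measurable_prodMk_left
  have h := lintegral_weight_volterra_le (hβ.const_mul k)
    (lintegral_const_mul_ne_top hk hβ hβ') hDu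
  calc ∫⁻ v, k * (planeWeight k α β (u, v) * vVolterra β D (u, v))
      = ∫⁻ v, weight (fun x => k * α x) u *
          (weight (fun x => k * β x) v * (k * β v * ∫⁻ z in Iic v, D (u, z))) := by
        refine lintegral_congr fun v => ?_
        simp only [planeWeight, vVolterra]; ring
    _ = weight (fun x => k * α x) u *
          ∫⁻ v, weight (fun x => k * β x) v * (k * β v * ∫⁻ z in Iic v, D (u, z)) :=
        lintegral_const_mul' _ _ (ne_top_of_le_ne_top ENNReal.one_ne_top (weight_le_one _ _))
    _ ≤ weight (fun x => k * α x) u * ∫⁻ v, weight (fun x => k * β x) v * D (u, v) := by gcongr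
    _ = ∫⁻ v, planeWeight k α β (u, v) * D (u, v) := by
        rw [← lintegral_const_mul' _ _
          (ne_top_of_le_ne_top ENNReal.one_ne_top (weight_le_one _ _))]
        refine lintegral_congr fun v => ?_
        simp only [planeWeight]; ring

theorem lintegral_planeWeight_uVolterra_le (hk : k ≠ ∞) (hα : Measurable α)
    (hα' : ∫⁻ x, α x ≠ ∞) (hβ : Measurable β) (hβ' : ∫⁻ x, β x ≠ ∞) (hD : Measurable D) :
    k * ∫⁻ q, planeWeight k α β q * uVolterra α D q ≤ ∫⁻ q, planeWeight k α β q * D q := by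
  have h := lintegral_planeWeight_vVolterra_le hk hβ hβ' hα hα' (hD.comp measurable_swap)
  rw [← lintegral_plane_swap fun q => planeWeight k α β q * uVolterra α D q,
    ← lintegral_plane_swap fun q => planeWeight k α β q * D q]
  simp only [planeWeight_swap, uVolterra_swap]
  exact h

theorem lintegral_planeWeight_uVolterra_vVolterra_le (hk : k ≠ ∞) (hα : Measurable α)
    (hα' : ∫⁻ x, α x ≠ ∞) (hβ : Measurable β) (hβ' : ∫⁻ x, β x ≠ ∞) (hD : Measurable D) :
    k * k * ∫⁻ q, planeWeight k α β q * uVolterra α (vVolterra β D) q ≤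
      ∫⁻ q, planeWeight k α β q * D q := by
  rw [mul_assoc]
  exact (mul_le_mul_right (lintegral_planeWeight_uVolterra_le hk hα hα' hβ hβ'
    (measurable_vVolterra hβ hD)) k).trans
    (lintegral_planeWeight_vVolterra_le hk hα hα' hβ hβ' hD)

/-- The Volterra operators of the wave map system contract the weighted norm. -/
theorem lintegral_planeWeight_contraction (hα : Measurable α)
    (hα' : ∫⁻ x, α x ≠ ∞) (hβ : Measurable β) (hβ' : ∫⁻ x, β x ≠ ∞) (hD : Measurable D) :
    ∫⁻ q, planeWeight 16 α β q *
      (2 * (vVolterra β D q + uVolterra α D q + uVolterra α (vVolterra β D) q)) ≤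
      2⁻¹ * ∫⁻ q, planeWeight 16 α β q * D q := by
  have hk : (16 : ℝ≥0∞) ≠ ∞ := by norm_num
  have mW := measurable_planeWeight hk hα hα' hβ hβ'
  have mV := measurable_vVolterra hβ hD
  have mU := measurable_uVolterra hα hD
  have mUV := measurable_uVolterra hα mV
  have h1 := lintegral_planeWeight_vVolterra_le hk hα hα' hβ hβ' hD
  have h2 := lintegral_planeWeight_uVolterra_le hk hα hα' hβ hβ' hD
  have h3 := lintegral_planeWeight_uVolterra_vVolterra_le hk hα hα' hβ hβ' hD
  have e : ∫⁻ q, planeWeight 16 α β q *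
      (2 * (vVolterra β D q + uVolterra α D q + uVolterra α (vVolterra β D) q)) =
      2 * ((∫⁻ q, planeWeight 16 α β q * vVolterra β D q) +
        (∫⁻ q, planeWeight 16 α β q * uVolterra α D q) +
        ∫⁻ q, planeWeight 16 α β q * uVolterra α (vVolterra β D) q) := by
    have m1 : Measurable fun q => planeWeight 16 α β q * vVolterra β D q := mW.mul mV
    have m2 : Measurable fun q => planeWeight 16 α β q * vVolterra β D q +
      planeWeight 16 α β q * uVolterra α D q := m1.add (mW.mul mU)
    have m3 : Measurable fun q => planeWeight 16 α β q * vVolterra β D q +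
      planeWeight 16 α β q * uVolterra α D q +
      planeWeight 16 α β q * uVolterra α (vVolterra β D) q := m2.add (mW.mul mUV)
    rw [← lintegral_add_left m1, ← lintegral_add_left m2, ← lintegral_const_mul _ m3]
    refine lintegral_congr fun q => ?_
    ring
  rw [e]
  set N := ∫⁻ q, planeWeight 16 α β q * D q
  set A := ∫⁻ q, planeWeight 16 α β q * vVolterra β D q
  set B := ∫⁻ q, planeWeight 16 α β q * uVolterra α D q
  set C := ∫⁻ q, planeWeight 16 α β q * uVolterra α (vVolterra β D) q
  rw [← ENNReal.div_eq_inv_mul, ENNReal.le_div_iff_mul_le (by simp) (by simp)]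
  -- The claim is `4 (A + B + C) ≤ N`, while `16 A`, `16 B` and `256 C` are each at most `N`. The
  -- factor 2 on the left of the statement makes room for the Lipschitz constant of the retraction
  -- used later.
  have h16 : (16 : ℝ≥0∞) * (2 * (A + B + C) * 2) ≤ 16 * N := by
    calc (16 : ℝ≥0∞) * (2 * (A + B + C) * 2) ≤ 4 * (16 * A) + 4 * (16 * B) + 4 * (16 * 16 * C) := by
          have : (16 : ℝ≥0∞) * (2 * (A + B + C) * 2) =
            4 * (16 * A) + 4 * (16 * B) + 4 * (16 * 1 * C) := by ring
          rw [this]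
          gcongr
          norm_num
      _ ≤ 4 * N + 4 * N + 4 * N := by gcongr
      _ = 12 * N := by ring
      _ ≤ 16 * N := by gcongr; norm_num
  exact (ENNReal.mul_le_mul_iff_right (by norm_num) hk).1 h16

end Volterra

/-! ### Lipschitz dependence on the data -/

section Stability

variable {E : Type*} [NormedAddCommGroup E] [InnerProductSpace ℝ E]

/-- The factors are changed one at a time. Only `y`, `x'`, `y'` remain as coefficients, and these
are bounded by the data, through conservation or through retraction. -/
theorem enorm_inner_smul_sub_le (x x' y y' p p' : E) (hp : ‖p‖ ≤ 1) :
    ‖inner ℝ x y • p - inner ℝ x' y' • p'‖ₑ ≤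
      ‖y‖ₑ * ‖x - x'‖ₑ + ‖x'‖ₑ * ‖y - y'‖ₑ + ‖x'‖ₑ * ‖y'‖ₑ * ‖p - p'‖ₑ := by
  have e : inner ℝ x y • p - inner ℝ x' y' • p' =
      inner ℝ (x - x') y • p + inner ℝ x' (y - y') • p + inner ℝ x' y' • (p - p') := by
    rw [inner_sub_left, inner_sub_right, sub_smul, sub_smul, smul_sub]; abel
  have n1 : ‖inner ℝ (x - x') y • p‖ ≤ ‖y‖ * ‖x - x'‖ := by
    rw [norm_smul, mul_comm ‖y‖]
    exact (mul_le_of_le_one_right (norm_nonneg _) hp).trans (norm_inner_le_norm _ _)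
  have n2 : ‖inner ℝ x' (y - y') • p‖ ≤ ‖x'‖ * ‖y - y'‖ := by
    rw [norm_smul]
    exact (mul_le_of_le_one_right (norm_nonneg _) hp).trans (norm_inner_le_norm _ _)
  have n3 : ‖inner ℝ x' y' • (p - p')‖ ≤ ‖x'‖ * ‖y'‖ * ‖p - p'‖ := by
    rw [norm_smul]
    gcongr
    exact norm_inner_le_norm _ _
  have n := (norm_add₃_le (a := inner ℝ (x - x') y • p) (b := inner ℝ x' (y - y') • p)
    (c := inner ℝ x' y' • (p - p'))).trans (add_le_add (add_le_add n1 n2) n3)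
  rw [← e] at n
  simp only [← ofReal_norm]
  rw [← ENNReal.ofReal_mul (norm_nonneg _), ← ENNReal.ofReal_mul (norm_nonneg _),
    ← ENNReal.ofReal_mul (norm_nonneg _), ← ENNReal.ofReal_mul (by positivity),
    ← ENNReal.ofReal_add (by positivity) (by positivity),
    ← ENNReal.ofReal_add (by positivity) (by positivity)]
  exact ENNReal.ofReal_le_ofReal n

variable {c c' : E} {a b a' b' : ℝ → E} {f f' : ℝ × ℝ → E}

theorem ae_enorm_uSlope_sub_le (a a' : ℝ → E) (hf : Integrable f) (hf' : Integrable f') :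
    ∀ᵐ u, ∀ v, ‖uSlope a f u v - uSlope a' f' u v‖ₑ ≤
      ‖a u - a' u‖ₑ + ∫⁻ z in Iic v, ‖f (u, z) - f' (u, z)‖ₑ := by
  filter_upwards [ae_integrable_section hf, ae_integrable_section hf'] with u h h' v
  have e : uSlope a f u v - uSlope a' f' u v =
      (a u - a' u) - ∫ z in Iic v, (f (u, z) - f' (u, z)) := by
    rw [integral_sub h.integrableOn h'.integrableOn, uSlope, uSlope]; abel
  rw [e]
  refine (enorm_sub_le).trans ?_
  gcongr
  exact enorm_integral_le_lintegral_enorm _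

theorem ae_enorm_vSlope_sub_le (b b' : ℝ → E) (hf : Integrable f) (hf' : Integrable f') :
    ∀ᵐ v, ∀ u, ‖vSlope b f u v - vSlope b' f' u v‖ₑ ≤
      ‖b v - b' v‖ₑ + ∫⁻ w in Iic u, ‖f (w, v) - f' (w, v)‖ₑ := by
  filter_upwards [ae_enorm_uSlope_sub_le b b' (integrable_comp_swap hf)
    (integrable_comp_swap hf')] with v hv u
  exact hv u

theorem enorm_wave_sub_le (ha : Integrable a) (ha' : Integrable a') (hb : Integrable b)
    (hb' : Integrable b') (hf : Integrable f) (hf' : Integrable f') (u v : ℝ) :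
    ‖wave c a b f u v - wave c' a' b' f' u v‖ₑ ≤
      (‖c - c'‖ₑ + (∫⁻ w, ‖a w - a' w‖ₑ) + ∫⁻ z, ‖b z - b' z‖ₑ) +
        ∫⁻ w in Iic u, ∫⁻ z in Iic v, ‖f (w, z) - f' (w, z)‖ₑ := by
  have e : wave c a b f u v - wave c' a' b' f' u v =
      ((c - c') + (∫ w in Iic u, (a w - a' w)) + ∫ z in Iic v, (b z - b' z)) -
        ∫ q in Iic u ×ˢ Iic v, (f q - f' q) := by
    rw [integral_sub ha.integrableOn ha'.integrableOn, integral_sub hb.integrableOn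
      hb'.integrableOn, integral_sub hf.integrableOn hf'.integrableOn, wave, wave]
    abel
  have l1 : ∀ {g : ℝ → E} (t : ℝ), ‖∫ w in Iic t, g w‖ₑ ≤ ∫⁻ w, ‖g w‖ₑ := fun t =>
    (enorm_integral_le_lintegral_enorm _).trans (setLIntegral_le_lintegral _ _)
  rw [e]
  refine (enorm_sub_le).trans ?_
  refine add_le_add ((enorm_add_le _ _).trans (add_le_add ((enorm_add_le _ _).trans
    (add_le_add le_rfl (l1 u))) (l1 v))) ?_
  refine (enorm_integral_le_lintegral_enorm _).trans (le_of_eq ?_)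
  have hm : AEMeasurable (fun q : ℝ × ℝ => ‖f q - f' q‖ₑ) (volume.prod volume) := by
    rw [← Measure.volume_eq_prod]; exact (hf.1.sub hf'.1).enorm
  rw [Measure.volume_eq_prod]
  exact setLIntegral_prod _ hm.restrict

theorem uVolterra_vVolterra_apply {α β : ℝ → ℝ≥0∞} {D : ℝ × ℝ → ℝ≥0∞} (hD : Measurable D)
    (u v : ℝ) : uVolterra α (vVolterra β D) (u, v) =
      α u * β v * ∫⁻ w in Iic u, ∫⁻ z in Iic v, D (w, z) := by
  have hm : Measurable fun w => ∫⁻ z in Iic v, D (w, z) :=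
    Measurable.lintegral_prod_right' (f := D) (ν := volume.restrict (Iic v)) hD
  simp only [uVolterra, vVolterra]
  rw [lintegral_const_mul _ hm, mul_assoc]

/-- Lipschitz dependence of the mixed derivative on the data. -/
theorem IsSolution.lintegral_enorm_sub_le [CompleteSpace E] (h : IsSolution c a b f)
    (h' : IsSolution c' a' b' f') {M : ℝ≥0∞} (hM : M ≠ ∞)
    (hα : ∫⁻ x, (‖a x‖ₑ + ‖a' x‖ₑ) ≤ M) (hβ : ∫⁻ x, (‖b x‖ₑ + ‖b' x‖ₑ) ≤ M) :
    ENNReal.ofReal (Real.exp (-(16 * M).toReal)) * ENNReal.ofReal (Real.exp (-(16 * M).toReal)) *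
      ∫⁻ q, ‖f q - f' q‖ₑ ≤
    2 * ((M + M + M * M) *
      (‖c - c'‖ₑ + (∫⁻ w, ‖a w - a' w‖ₑ) + ∫⁻ z, ‖b z - b' z‖ₑ)) := by
  set α : ℝ → ℝ≥0∞ := fun x => ‖a x‖ₑ + ‖a' x‖ₑ with hαdef
  set β : ℝ → ℝ≥0∞ := fun x => ‖b x‖ₑ + ‖b' x‖ₑ with hβdef
  set D : ℝ × ℝ → ℝ≥0∞ := fun q => ‖f q - f' q‖ₑ with hDdef
  set δ := ‖c - c'‖ₑ + (∫⁻ w, ‖a w - a' w‖ₑ) + ∫⁻ z, ‖b z - b' z‖ₑ with hδ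
  have mα : Measurable α := h.meas_a.enorm.add h'.meas_a.enorm
  have mβ : Measurable β := h.meas_b.enorm.add h'.meas_b.enorm
  have mD : Measurable D := (h.meas_f.sub h'.meas_f).enorm
  have fα := ne_top_of_le_ne_top hM hα
  have fβ := ne_top_of_le_ne_top hM hβ
  have hk : (16 : ℝ≥0∞) ≠ ∞ := by norm_num
  have mW := measurable_planeWeight hk mα fα mβ fβ
  have mda : Measurable fun u => ‖a u - a' u‖ₑ := (h.meas_a.sub h'.meas_a).enorm
  have mdb : Measurable fun u => ‖b u - b' u‖ₑ := (h.meas_b.sub h'.meas_b).enorm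
  set G : ℝ × ℝ → ℝ≥0∞ := fun q => ‖a q.1 - a' q.1‖ₑ * β q.2 + α q.1 * ‖b q.2 - b' q.2‖ₑ +
    δ * (α q.1 * β q.2) with hG
  set K : ℝ × ℝ → ℝ≥0∞ := fun q =>
    2 * (vVolterra β D q + uVolterra α D q + uVolterra α (vVolterra β D) q) with hK
  -- Conservation replaces the slopes in the coefficients by the data, so the inequality is linear
  -- in `D`; `G` collects the contribution of the data differences.
  have key : ∀ᵐ q, D q ≤ K q + G q := by
    filter_upwards [h.eq, h'.eq, ae_prod_of_ae_fst (ae_enorm_uSlope_sub_le a a' h.int_f h'.int_f),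
      ae_prod_of_ae_snd (ae_enorm_vSlope_sub_le b b' h.int_f h'.int_f),
      ae_prod_of_ae_fst h'.ae_norm_uSlope, ae_prod_of_ae_snd h.ae_norm_vSlope,
      ae_prod_of_ae_snd h'.ae_norm_vSlope] with ⟨u, v⟩ e e' dU dV nU' nV nV'
    have dW := enorm_wave_sub_le (c := c) (c' := c') h.int_a h'.int_a h.int_b h'.int_b h.int_f
      h'.int_f u v
    have nU'' : ‖uSlope a' f' u v‖ₑ = ‖a' u‖ₑ := by rw [← ofReal_norm, nU' v, ofReal_norm]
    have nV₁ : ‖vSlope b f u v‖ₑ = ‖b v‖ₑ := by rw [← ofReal_norm, nV u, ofReal_norm]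
    have nV₂ : ‖vSlope b' f' u v‖ₑ = ‖b' v‖ₑ := by rw [← ofReal_norm, nV' u, ofReal_norm]
    have hd := enorm_inner_smul_sub_le (uSlope a f u v) (uSlope a' f' u v) (vSlope b f u v)
      (vSlope b' f' u v) (wave c a b f u v) (wave c' a' b' f' u v) (h.norm_wave u v).le
    rw [nU'', nV₁, nV₂] at hd
    simp only [hDdef, e, e']
    have la : ‖a' u‖ₑ ≤ α u := le_add_self
    have lb : ‖b v‖ₑ ≤ β v := le_self_add
    have lb' : ‖b' v‖ₑ ≤ β v := le_add_self
    calc _ ≤ _ := hd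
      _ ≤ β v * (‖a u - a' u‖ₑ + ∫⁻ z in Iic v, D (u, z)) +
          α u * (‖b v - b' v‖ₑ + ∫⁻ w in Iic u, D (w, v)) +
          α u * β v * (δ + ∫⁻ w in Iic u, ∫⁻ z in Iic v, D (w, z)) := by
          gcongr
          · exact dU v
          · exact dV u
      _ = (vVolterra β D (u, v) + uVolterra α D (u, v) + uVolterra α (vVolterra β D) (u, v)) +
          G (u, v) := by
          rw [uVolterra_vVolterra_apply mD, vVolterra, uVolterra]; simp only [hG]; ring
      _ ≤ K (u, v) + G (u, v) := by
          gcongr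
          exact le_mul_of_one_le_left zero_le (by norm_num)
  have hKN : ∫⁻ q, planeWeight 16 α β q * K q ≤ 2⁻¹ * ∫⁻ q, planeWeight 16 α β q * D q :=
    lintegral_planeWeight_contraction mα fα mβ fβ mD
  have mK : Measurable K := ((((measurable_vVolterra mβ mD)).add (measurable_uVolterra mα mD)).add
    (measurable_uVolterra mα (measurable_vVolterra mβ mD))).const_mul 2
  have prodInt : ∀ {g k : ℝ → ℝ≥0∞}, Measurable g → Measurable k →
      ∫⁻ q : ℝ × ℝ, g q.1 * k q.2 = (∫⁻ u, g u) * ∫⁻ v, k v := by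
    intro g k hg hk
    rw [Measure.volume_eq_prod]
    exact lintegral_prod_mul hg.aemeasurable hk.aemeasurable
  -- The coefficients `β`, `α` and `α β` in `G` have masses at most `M`, `M` and `M * M`.
  have hGN : ∫⁻ q, planeWeight 16 α β q * G q ≤ (M + M + M * M) * δ := by
    have m1 : Measurable fun q : ℝ × ℝ => ‖a q.1 - a' q.1‖ₑ * β q.2 :=
      (mda.comp measurable_fst).mul (mβ.comp measurable_snd)
    have m2 : Measurable fun q : ℝ × ℝ => ‖a q.1 - a' q.1‖ₑ * β q.2 +
        α q.1 * ‖b q.2 - b' q.2‖ₑ :=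
      m1.add ((mα.comp measurable_fst).mul (mdb.comp measurable_snd))
    have m3 : Measurable fun q : ℝ × ℝ => α q.1 * β q.2 :=
      (mα.comp measurable_fst).mul (mβ.comp measurable_snd)
    calc ∫⁻ q, planeWeight 16 α β q * G q ≤ ∫⁻ q, G q :=
          lintegral_mono fun q => mul_le_of_le_one_left zero_le (planeWeight_le_one q)
      _ = (∫⁻ u, ‖a u - a' u‖ₑ) * (∫⁻ v, β v) + (∫⁻ u, α u) * (∫⁻ v, ‖b v - b' v‖ₑ) +
          δ * ((∫⁻ u, α u) * ∫⁻ v, β v) := by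
          rw [hG, lintegral_add_left m2, lintegral_add_left m1, lintegral_const_mul _ m3,
            prodInt mda mβ, prodInt mα mdb, prodInt mα mβ]
      _ ≤ δ * M + M * δ + δ * (M * M) := by
          gcongr
          · exact le_add_self.trans le_self_add
          · exact le_add_self
      _ = (M + M + M * M) * δ := by ring
  -- Finiteness allows half of the weighted norm to be absorbed on the left.
  have hfin : ∫⁻ q, planeWeight 16 α β q * D q ≠ ∞ := by
    refine ne_top_of_le_ne_top (h.int_f.sub h'.int_f).2.ne (lintegral_mono fun q => ?_)
    exact mul_le_of_le_one_left zero_le (planeWeight_le_one q)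
  have hN : ∫⁻ q, planeWeight 16 α β q * D q ≤
      2⁻¹ * (∫⁻ q, planeWeight 16 α β q * D q) + (M + M + M * M) * δ := by
    have mWK : Measurable fun q => planeWeight 16 α β q * K q := mW.mul mK
    calc _ ≤ ∫⁻ q, (planeWeight 16 α β q * K q + planeWeight 16 α β q * G q) := by
          refine lintegral_mono_ae ?_
          filter_upwards [key] with q hq
          rw [← mul_add]
          gcongr
      _ = (∫⁻ q, planeWeight 16 α β q * K q) + ∫⁻ q, planeWeight 16 α β q * G q :=
          lintegral_add_left mWK _
      _ ≤ _ := add_le_add hKN hGN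
  have hN2 : ∫⁻ q, planeWeight 16 α β q * D q ≤ 2 * ((M + M + M * M) * δ) := by
    set N := ∫⁻ q, planeWeight 16 α β q * D q
    have t : 2 * N ≤ N + 2 * ((M + M + M * M) * δ) := by
      calc 2 * N ≤ 2 * (2⁻¹ * N + (M + M + M * M) * δ) := by gcongr
        _ = 2 * 2⁻¹ * N + 2 * ((M + M + M * M) * δ) := by ring
        _ = _ := by rw [ENNReal.mul_inv_cancel (by norm_num) (by norm_num), one_mul]
    rw [two_mul] at t
    exact (ENNReal.add_le_add_iff_left hfin).1 t
  refine le_trans ?_ hN2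
  rw [← lintegral_const_mul _ mD]
  refine lintegral_mono fun q => ?_
  gcongr
  exact exp_le_planeWeight hk mα mβ hM hα hβ q

theorem IsSolution.ae_eq [CompleteSpace E] (h : IsSolution c a b f) (h' : IsSolution c a b f') :
    f =ᵐ[volume] f' := by
  have fin : ∀ {g : ℝ → E}, StronglyMeasurable g → Integrable g →
      ∫⁻ x, (‖g x‖ₑ + ‖g x‖ₑ) ≠ ∞ := fun hg hg' => by
    rw [lintegral_add_left hg.enorm]
    exact ENNReal.add_ne_top.2 ⟨hg'.2.ne, hg'.2.ne⟩
  have key := h.lintegral_enorm_sub_le h'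
    (ENNReal.add_ne_top.2 ⟨fin h.meas_a h.int_a, fin h.meas_b h.int_b⟩) le_self_add le_add_self
  simp only [sub_self, enorm_zero, lintegral_zero, add_zero, mul_zero, nonpos_iff_eq_zero,
    mul_eq_zero, ENNReal.ofReal_eq_zero, not_le.2 (Real.exp_pos _), false_or] at key
  have mD : Measurable fun q => ‖f q - f' q‖ₑ := (h.meas_f.sub h'.meas_f).enorm
  rw [lintegral_eq_zero_iff mD] at key
  filter_upwards [key] with q hq
  simpa [sub_eq_zero] using hq

end Stability

/-! ### The radial retraction onto a ball -/

section Clip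

variable {E : Type*} [NormedAddCommGroup E] [NormedSpace ℝ E]

/-- The radial retraction onto the closed ball of radius `r`. -/
noncomputable def clip (r : ℝ) (x : E) : E := min 1 (r / ‖x‖) • x

theorem clip_of_norm_le {r : ℝ} {x : E} (h : ‖x‖ ≤ r) : clip r x = x := by
  rcases eq_or_ne x 0 with rfl | hx
  -- Here `r / ‖x‖` is `r / 0 = 0`, which is harmless since the factor multiplies zero.
  · simp [clip]
  · rw [clip, min_eq_left, one_smul]
    rwa [le_div_iff₀ (norm_pos_iff.2 hx), one_mul]

theorem clip_of_lt_norm {r : ℝ} (hr : 0 ≤ r) {x : E} (h : r < ‖x‖) :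
    clip r x = (r / ‖x‖) • x := by
  rw [clip, min_eq_right]
  rw [div_le_one (hr.trans_lt h)]; exact h.le

theorem norm_clip_of_lt_norm {r : ℝ} (hr : 0 ≤ r) {x : E} (h : r < ‖x‖) : ‖clip r x‖ = r := by
  rw [clip_of_lt_norm hr h, norm_smul, norm_div, norm_norm, Real.norm_of_nonneg hr,
    div_mul_cancel₀ _ (hr.trans_lt h).ne']

theorem norm_clip_le {r : ℝ} (hr : 0 ≤ r) (x : E) : ‖clip r x‖ ≤ r := by
  rcases le_or_gt ‖x‖ r with h | h
  · rwa [clip_of_norm_le h]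
  · rw [norm_clip_of_lt_norm hr h]

theorem exists_clip_eq_smul {r : ℝ} (hr : 0 ≤ r) (x : E) :
    ∃ s : ℝ, 0 ≤ s ∧ s ≤ 1 ∧ clip r x = s • x :=
  ⟨_, by positivity, min_le_left _ _, rfl⟩

theorem norm_sub_clip {r : ℝ} (hr : 0 ≤ r) {x : E} (h : r < ‖x‖) :
    ‖x - clip r x‖ = ‖x‖ - r := by
  have hx : 0 < ‖x‖ := hr.trans_lt h
  have e : x - clip r x = (1 - r / ‖x‖) • x := by rw [clip_of_lt_norm hr h, sub_smul, one_smul]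
  rw [e, norm_smul, Real.norm_of_nonneg (by rw [sub_nonneg, div_le_one hx]; exact h.le), sub_mul,
    one_mul, div_mul_cancel₀ _ hx.ne']

/-- If only `y` lies outside the ball, its retraction moves it by `‖y‖ - r ≤ ‖x - y‖`; if both
points do, rescaling them to equal norm costs one more `‖x - y‖`. The constant 2 is valid in every
normed space and small enough for the contraction. -/
theorem norm_clip_sub_clip_le {r : ℝ} (hr : 0 ≤ r) (x y : E) :
    ‖clip r x - clip r y‖ ≤ 2 * ‖x - y‖ := by
  have mixed : ∀ x y : E, ‖x‖ ≤ r → r < ‖y‖ → ‖clip r x - clip r y‖ ≤ 2 * ‖x - y‖ := by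
    intro x y hx hy
    rw [clip_of_norm_le hx]
    have h1 : ‖x - clip r y‖ ≤ ‖x - y‖ + ‖y - clip r y‖ := by
      rw [← sub_add_sub_cancel x y]; exact norm_add_le _ _
    rw [norm_sub_clip hr hy] at h1
    have := norm_sub_norm_le y x
    rw [norm_sub_rev] at this
    linarith
  rcases le_or_gt ‖x‖ r with hx | hx <;> rcases le_or_gt ‖y‖ r with hy | hy
  · rw [clip_of_norm_le hx, clip_of_norm_le hy]; linarith [norm_nonneg (x - y)]
  · exact mixed x y hx hy
  · rw [norm_sub_rev, norm_sub_rev x]; exact mixed y x hy hx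
  · have hx0 := hr.trans_lt hx
    have hy0 := hr.trans_lt hy
    rw [clip_of_lt_norm hr hx, clip_of_lt_norm hr hy]
    have e : (r / ‖x‖) • x - (r / ‖y‖) • y =
        (r / ‖x‖) • ((x - y) + ((‖y‖ - ‖x‖) / ‖y‖) • y) := by
      have h1 : (‖y‖ - ‖x‖) / ‖y‖ = 1 - ‖x‖ / ‖y‖ := by field_simp
      have h2 : r / ‖y‖ = r / ‖x‖ * (‖x‖ / ‖y‖) := by field_simp
      rw [h1, h2, sub_smul, one_smul, mul_smul]
      module
    rw [e, norm_smul, norm_div, norm_norm, Real.norm_of_nonneg hr]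
    have h3 : r / ‖x‖ ≤ 1 := by rw [div_le_one hx0]; exact hx.le
    refine (mul_le_of_le_one_left (norm_nonneg _) h3).trans ((norm_add_le _ _).trans ?_)
    rw [norm_smul, norm_div, norm_norm, div_mul_cancel₀ _ hy0.ne', two_mul, Real.norm_eq_abs]
    gcongr
    rw [norm_sub_rev]
    exact abs_norm_sub_norm_le y x

theorem enorm_clip_sub_clip_le {r : ℝ} (hr : 0 ≤ r) (x y : E) :
    ‖clip r x - clip r y‖ₑ ≤ 2 * ‖x - y‖ₑ := by
  rw [← ofReal_norm, ← ofReal_norm, ← ENNReal.ofReal_ofNat 2, ← ENNReal.ofReal_mul (by norm_num)]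
  exact ENNReal.ofReal_le_ofReal (norm_clip_sub_clip_le hr x y)

theorem enorm_clip_le {F : Type*} [NormedAddCommGroup F] (y : F) (x : E) :
    ‖clip ‖y‖ x‖ₑ ≤ ‖y‖ₑ := by
  rw [← ofReal_norm, ← ofReal_norm]
  exact ENNReal.ofReal_le_ofReal (norm_clip_le (norm_nonneg y) x)

theorem stronglyMeasurable_clip {X : Type*} [MeasurableSpace X] {r : X → ℝ} {x : X → E}
    (hr : StronglyMeasurable r) (hx : StronglyMeasurable x) :
    StronglyMeasurable fun t => clip (r t) (x t) :=
  (measurable_const.min (hr.measurable.div hx.norm.measurable)).stronglyMeasurable.smul hx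

end Clip

/-! ### Fixed point of the retracted system -/

section Truncated

variable {E : Type*} [NormedAddCommGroup E] [InnerProductSpace ℝ E]

/-- The source term of the wave map system, with the slopes and the map retracted onto the balls
in which they lie for an actual wave map. -/
noncomputable def clippedSource (c : E) (a b : ℝ → E) (f : ℝ × ℝ → E) (q : ℝ × ℝ) : E :=
  inner ℝ (clip ‖a q.1‖ (uSlope a f q.1 q.2)) (clip ‖b q.2‖ (vSlope b f q.1 q.2)) •
    clip 1 (wave c a b f q.1 q.2)

variable {c : E} {a b : ℝ → E} {f g : ℝ × ℝ → E}

/-- The bound does not involve `f`, so the retracted source maps all of L¹ into L¹. -/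
theorem norm_clippedSource_le (c : E) (a b : ℝ → E) (f : ℝ × ℝ → E) (q : ℝ × ℝ) :
    ‖clippedSource c a b f q‖ ≤ ‖a q.1‖ * ‖b q.2‖ := by
  rw [clippedSource, norm_smul]
  refine (mul_le_of_le_one_right (norm_nonneg _) (norm_clip_le zero_le_one _)).trans
    ((norm_inner_le_norm _ _).trans ?_)
  exact mul_le_mul (norm_clip_le (norm_nonneg _) _) (norm_clip_le (norm_nonneg _) _)
    (norm_nonneg _) (norm_nonneg _)

theorem stronglyMeasurable_clippedSource (ha : StronglyMeasurable a) (ha' : Integrable a)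
    (hb : StronglyMeasurable b) (hb' : Integrable b) (hf : StronglyMeasurable f)
    (hf' : Integrable f) : StronglyMeasurable (clippedSource c a b f) := by
  refine StronglyMeasurable.smul (StronglyMeasurable.inner ?_ ?_) ?_
  · exact stronglyMeasurable_clip (ha.norm.comp_measurable measurable_fst)
      (stronglyMeasurable_uSlope ha hf)
  · exact stronglyMeasurable_clip (hb.norm.comp_measurable measurable_snd)
      (stronglyMeasurable_vSlope hb hf)
  · exact stronglyMeasurable_clip stronglyMeasurable_const
      (stronglyMeasurable_wave ha ha' hb' hf hf')

theorem integrable_clippedSource (ha : StronglyMeasurable a) (ha' : Integrable a)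
    (hb : StronglyMeasurable b) (hb' : Integrable b) (hf : StronglyMeasurable f)
    (hf' : Integrable f) : Integrable (clippedSource c a b f) := by
  have h : Integrable fun q : ℝ × ℝ => ‖a q.1‖ * ‖b q.2‖ := by
    rw [Measure.volume_eq_prod]; exact ha'.norm.mul_prod hb'.norm
  exact h.mono' (stronglyMeasurable_clippedSource ha ha' hb hb' hf hf').aestronglyMeasurable
    (Eventually.of_forall fun q => norm_clippedSource_le c a b f q)

theorem ae_enorm_clippedSource_sub_le (ha : Integrable a) (hb : Integrable b)
    (hf : StronglyMeasurable f) (hf' : Integrable f) (hg : StronglyMeasurable g)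
    (hg' : Integrable g) :
    ∀ᵐ q, ‖clippedSource c a b f q - clippedSource c a b g q‖ₑ ≤
      2 * (vVolterra (fun v => ‖b v‖ₑ) (fun q => ‖f q - g q‖ₑ) q +
        uVolterra (fun u => ‖a u‖ₑ) (fun q => ‖f q - g q‖ₑ) q +
        uVolterra (fun u => ‖a u‖ₑ) (vVolterra (fun v => ‖b v‖ₑ) (fun q => ‖f q - g q‖ₑ)) q) := by
  have mD : Measurable fun q => ‖f q - g q‖ₑ := (hf.sub hg).enorm
  filter_upwards [ae_prod_of_ae_fst (ae_enorm_uSlope_sub_le a a hf' hg'),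
    ae_prod_of_ae_snd (ae_enorm_vSlope_sub_le b b hf' hg')] with ⟨u, v⟩ dU dV
  have dW := enorm_wave_sub_le (c := c) (c' := c) ha ha hb hb hf' hg' u v
  simp only [sub_self, enorm_zero, lintegral_zero, zero_add] at dU dV dW
  refine (enorm_inner_smul_sub_le _ _ _ _ _ _ (norm_clip_le zero_le_one _)).trans ?_
  rw [uVolterra_vVolterra_apply mD, vVolterra, uVolterra]
  calc _ ≤ ‖b v‖ₑ * (2 * ∫⁻ z in Iic v, ‖f (u, z) - g (u, z)‖ₑ) +
        ‖a u‖ₑ * (2 * ∫⁻ w in Iic u, ‖f (w, v) - g (w, v)‖ₑ) +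
        ‖a u‖ₑ * ‖b v‖ₑ * (2 * ∫⁻ w in Iic u, ∫⁻ z in Iic v, ‖f (w, z) - g (w, z)‖ₑ) := by
        gcongr
        · exact enorm_clip_le _ _
        · exact (enorm_clip_sub_clip_le (norm_nonneg _) _ _).trans (by gcongr; exact dU v)
        · exact enorm_clip_le _ _
        · exact (enorm_clip_sub_clip_le (norm_nonneg _) _ _).trans (by gcongr; exact dV u)
        · exact enorm_clip_le _ _
        · exact enorm_clip_le _ _
        · exact (enorm_clip_sub_clip_le zero_le_one _ _).trans (by gcongr)
    _ = _ := by ring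

variable [CompleteSpace E]

theorem exists_eq_clippedSource (c : E) (ha : StronglyMeasurable a) (ha' : Integrable a)
    (hb : StronglyMeasurable b) (hb' : Integrable b) :
    ∃ f : ℝ × ℝ → E, StronglyMeasurable f ∧ Integrable f ∧
      ∀ᵐ q, f q = clippedSource c a b f q := by
  set α : ℝ → ℝ≥0∞ := fun u => ‖a u‖ₑ
  set β : ℝ → ℝ≥0∞ := fun u => ‖b u‖ₑ
  have mα : Measurable α := ha.enorm
  have mβ : Measurable β := hb.enorm
  have fα : ∫⁻ u, α u ≠ ∞ := ha'.2.ne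
  have fβ : ∫⁻ u, β u ≠ ∞ := hb'.2.ne
  have hk : (16 : ℝ≥0∞) ≠ ∞ := by norm_num
  have mW := measurable_planeWeight hk mα fα mβ fβ
  set M := (∫⁻ u, α u) + ∫⁻ u, β u
  have hM : M ≠ ∞ := ENNReal.add_ne_top.2 ⟨fα, fβ⟩
  set ω := ENNReal.ofReal (Real.exp (-(16 * M).toReal)) *
    ENNReal.ofReal (Real.exp (-(16 * M).toReal))
  have hω : ∀ q, ω ≤ planeWeight 16 α β q :=
    exp_le_planeWeight hk mα mβ hM le_self_add le_add_self
  have ω0 : ω ≠ 0 := mul_ne_zero (by simp [Real.exp_pos]) (by simp [Real.exp_pos])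
  have ω1 : ω ≠ ∞ := ENNReal.mul_ne_top ENNReal.ofReal_ne_top ENNReal.ofReal_ne_top
  -- The weight lies between `ω > 0` and 1, so L¹ of the weighted measure contains the same
  -- functions as plain L¹; only the norm changes, and in it the map contracts.
  set m : Measure (ℝ × ℝ) := volume.withDensity (planeWeight 16 α β)
  have hm1 : m ≤ volume := by
    refine (withDensity_mono (Eventually.of_forall planeWeight_le_one)).trans_eq ?_
    exact withDensity_one
  have hm2 : (volume : Measure (ℝ × ℝ)) ≤ ω⁻¹ • m := by
    have : (volume : Measure (ℝ × ℝ)) = ω⁻¹ • ω • volume := by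
      rw [smul_smul, ENNReal.inv_mul_cancel ω0 ω1, one_smul]
    rw [this, ← withDensity_const ω]
    refine Measure.le_iff.2 fun s _ => ?_
    simp only [Measure.smul_apply, smul_eq_mul]
    exact mul_le_mul_right (withDensity_mono (Eventually.of_forall hω) s) _
  have toVol : ∀ f : ℝ × ℝ →₁[m] E, Integrable f volume := fun f =>
    ((L1.integrable_coeFn f).smul_measure (ENNReal.inv_ne_top.2 ω0)).mono_measure hm2
  have intT : ∀ f : ℝ × ℝ →₁[m] E, Integrable (clippedSource c a b f) m := fun f =>
    (integrable_clippedSource ha ha' hb hb' (Lp.stronglyMeasurable f) (toVol f)).mono_measure hm1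
  let T : (ℝ × ℝ →₁[m] E) → (ℝ × ℝ →₁[m] E) := fun f => (intT f).toL1 _
  have hT : ContractingWith (2⁻¹) T := by
    refine ⟨by norm_num, fun f g => ?_⟩
    have mf := Lp.stronglyMeasurable f
    have mg := Lp.stronglyMeasurable g
    have mD : Measurable fun q => ‖f q - g q‖ₑ := (mf.sub mg).enorm
    have mS : Measurable fun q => ‖clippedSource c a b f q - clippedSource c a b g q‖ₑ :=
      ((stronglyMeasurable_clippedSource ha ha' hb hb' mf (toVol f)).sub
        (stronglyMeasurable_clippedSource ha ha' hb hb' mg (toVol g))).enorm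
    have e1 : edist (T f) (T g) = ∫⁻ q, planeWeight 16 α β q *
        ‖clippedSource c a b f q - clippedSource c a b g q‖ₑ := by
      rw [Integrable.edist_toL1_toL1]
      simp only [edist_eq_enorm_sub]
      exact lintegral_withDensity_eq_lintegral_mul _ mW mS
    have e2 : edist f g = ∫⁻ q, planeWeight 16 α β q * ‖f q - g q‖ₑ := by
      rw [L1.edist_def]
      simp only [edist_eq_enorm_sub]
      exact lintegral_withDensity_eq_lintegral_mul _ mW mD
    rw [e1, e2]
    refine (lintegral_mono_ae ?_).trans
      ((lintegral_planeWeight_contraction mα fα mβ fβ mD).trans_eq ?_)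
    · filter_upwards [ae_enorm_clippedSource_sub_le (c := c) ha' hb' mf (toVol f) mg (toVol g)]
        with q hq
      gcongr
    · norm_num
  set f := hT.fixedPoint T
  have hf : T f = f := hT.fixedPoint_isFixedPt
  refine ⟨f, Lp.stronglyMeasurable f, toVol f, ?_⟩
  have h1 : f =ᵐ[m] clippedSource c a b f := by
    conv_lhs => rw [← hf]
    exact (intT f).coeFn_toL1
  exact (withDensity_absolutelyContinuous' mW.aemeasurable
    (Eventually.of_forall fun q => (pos_of_ne_zero ω0 |>.trans_le (hω q)).ne')).ae_le h1

end Truncated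

/-! ### The fixed point satisfies the constraints -/

section Excess

variable {E : Type*} [NormedAddCommGroup E] [InnerProductSpace ℝ E]

/-- The part of the `u`-slope outside the ball of radius `‖a‖`. -/
noncomputable def uExcess (a : ℝ → E) (f : ℝ × ℝ → E) (u v : ℝ) : ℝ≥0∞ :=
  ‖uSlope a f u v - clip ‖a u‖ (uSlope a f u v)‖ₑ

/-- The part of the `v`-slope outside the ball of radius `‖b‖`. -/
noncomputable def vExcess (b : ℝ → E) (f : ℝ × ℝ → E) (u v : ℝ) : ℝ≥0∞ :=
  ‖vSlope b f u v - clip ‖b v‖ (vSlope b f u v)‖ₑ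

/-- The defect of `‖wave‖² = 1`. -/
noncomputable def sphereDefect (c : E) (a b : ℝ → E) (f : ℝ × ℝ → E) (u v : ℝ) : ℝ≥0∞ :=
  ‖‖wave c a b f u v‖ ^ 2 - 1‖ₑ

/-- The combined defect of the constraints for a solution of the clipped system. -/
noncomputable def defect (C : ℝ≥0∞) (c : E) (a b : ℝ → E) (f : ℝ × ℝ → E) (q : ℝ × ℝ) : ℝ≥0∞ :=
  C * (‖b q.2‖ₑ * uExcess a f q.1 q.2 + ‖a q.1‖ₑ * vExcess b f q.1 q.2 +
    ‖a q.1‖ₑ * ‖b q.2‖ₑ * sphereDefect c a b f q.1 q.2)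

/-- Solutions of the system with retracted source, with data on the sphere. -/
structure IsClippedSolution (c : E) (a b : ℝ → E) (f : ℝ × ℝ → E) : Prop where
  meas_a : StronglyMeasurable a
  meas_b : StronglyMeasurable b
  meas_f : StronglyMeasurable f
  int_a : Integrable a
  int_b : Integrable b
  int_f : Integrable f
  norm_u : ∀ u, ‖c + ∫ w in Iic u, a w‖ = 1
  norm_v : ∀ v, ‖c + ∫ z in Iic v, b z‖ = 1
  eq : ∀ᵐ q : ℝ × ℝ, f q = clippedSource c a b f q

variable {C : ℝ≥0∞} {c : E} {a b : ℝ → E} {f : ℝ × ℝ → E}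

theorem defect_swap (q : ℝ × ℝ) :
    defect C c b a (f ∘ Prod.swap) q = defect C c a b f q.swap := by
  obtain ⟨u, v⟩ := q
  simp only [defect, sphereDefect, uExcess, vExcess, wave_swap, uSlope_swap, vSlope_swap,
    Prod.fst_swap, Prod.snd_swap]
  ring

/-- Inside the ball both sides agree; outside, `⟨clip 1 x, x⟩ = ‖x‖` and `‖x‖ - 1 ≤ ‖x‖² - 1`. -/
theorem abs_one_sub_inner_clip_le (x : E) : |1 - inner ℝ (clip 1 x) x| ≤ |‖x‖ ^ 2 - 1| := by
  rcases le_or_gt ‖x‖ 1 with h | h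
  · rw [clip_of_norm_le h, real_inner_self_eq_norm_sq, abs_sub_comm]
  · have hx : 0 < ‖x‖ := zero_lt_one.trans h
    rw [clip_of_lt_norm zero_le_one h, real_inner_smul_left, real_inner_self_eq_norm_sq]
    have e : 1 / ‖x‖ * ‖x‖ ^ 2 = ‖x‖ := by field_simp
    rw [e, abs_sub_comm, abs_of_pos (by linarith), abs_of_pos (by nlinarith)]
    nlinarith

theorem enorm_inner_le (x y : E) : ‖inner ℝ x y‖ₑ ≤ ‖x‖ₑ * ‖y‖ₑ := by
  rw [← ofReal_norm, ← ofReal_norm, ← ofReal_norm, ← ENNReal.ofReal_mul (norm_nonneg _)]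
  exact ENNReal.ofReal_le_ofReal (norm_inner_le_norm _ _)

namespace IsClippedSolution

theorem swap (h : IsClippedSolution c a b f) : IsClippedSolution c b a (f ∘ Prod.swap) where
  meas_a := h.meas_b
  meas_b := h.meas_a
  meas_f := h.meas_f.comp_measurable measurable_swap
  int_a := h.int_b
  int_b := h.int_a
  int_f := integrable_comp_swap h.int_f
  norm_u := h.norm_v
  norm_v := h.norm_u
  eq := by
    filter_upwards [ae_swap h.eq] with q hq
    rw [Function.comp_apply, hq, clippedSource, clippedSource, uSlope_swap, vSlope_swap,
      wave_swap, real_inner_comm]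
    rfl

theorem measurable_uExcess (h : IsClippedSolution c a b f) :
    Measurable fun q : ℝ × ℝ => uExcess a f q.1 q.2 := by
  have hU := stronglyMeasurable_uSlope h.meas_a h.meas_f
  exact (hU.sub (stronglyMeasurable_clip
    (h.meas_a.norm.comp_measurable measurable_fst) hU)).enorm

theorem measurable_vExcess (h : IsClippedSolution c a b f) :
    Measurable fun q : ℝ × ℝ => vExcess b f q.1 q.2 :=
  h.swap.measurable_uExcess.comp measurable_swap

theorem measurable_sphereDefect (h : IsClippedSolution c a b f) :
    Measurable fun q : ℝ × ℝ => sphereDefect c a b f q.1 q.2 := by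
  have hw := (stronglyMeasurable_wave (c := c) h.meas_a h.int_a h.int_b h.meas_f h.int_f).norm
  exact ((hw.measurable.pow_const 2).sub_const 1).enorm

theorem measurable_defect (h : IsClippedSolution c a b f) (C : ℝ≥0∞) :
    Measurable (defect C c a b f) := by
  have ma : Measurable fun q : ℝ × ℝ => ‖a q.1‖ₑ := h.meas_a.enorm.comp measurable_fst
  have mb : Measurable fun q : ℝ × ℝ => ‖b q.2‖ₑ := h.meas_b.enorm.comp measurable_snd
  exact ((((mb.mul h.measurable_uExcess).add (ma.mul h.measurable_vExcess))).add
    ((ma.mul mb).mul h.measurable_sphereDefect)).const_mul C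

theorem ae_enorm_le (h : IsClippedSolution c a b f) :
    ∀ᵐ q : ℝ × ℝ, ‖f q‖ₑ ≤ ‖a q.1‖ₑ * ‖b q.2‖ₑ := by
  filter_upwards [h.eq] with q hq
  rw [hq, ← ofReal_norm, ← ofReal_norm, ← ofReal_norm, ← ENNReal.ofReal_mul (norm_nonneg _)]
  exact ENNReal.ofReal_le_ofReal (norm_clippedSource_le c a b f q)

/-- A crude bound from `‖f‖ ≤ ‖a‖ ‖b‖`. It makes the defect integrable and forces the slope to
vanish where `a` does. -/
theorem ae_enorm_uSlope_le (h : IsClippedSolution c a b f) :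
    ∀ᵐ u, ∀ v, ‖uSlope a f u v‖ₑ ≤ ‖a u‖ₑ * (1 + ∫⁻ z, ‖b z‖ₑ) := by
  filter_upwards [ae_ae_of_ae h.ae_enorm_le] with u hu v
  refine (enorm_sub_le).trans ?_
  rw [mul_add, mul_one]
  gcongr
  calc _ ≤ ∫⁻ z in Iic v, ‖f (u, z)‖ₑ := enorm_integral_le_lintegral_enorm _
    _ ≤ ∫⁻ z, ‖f (u, z)‖ₑ := setLIntegral_le_lintegral _ _
    _ ≤ ∫⁻ z, ‖a u‖ₑ * ‖b z‖ₑ := lintegral_mono_ae hu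
    _ = _ := lintegral_const_mul _ h.meas_b.enorm

theorem ae_enorm_vSlope_le (h : IsClippedSolution c a b f) :
    ∀ᵐ v, ∀ u, ‖vSlope b f u v‖ₑ ≤ ‖b v‖ₑ * (1 + ∫⁻ w, ‖a w‖ₑ) :=
  h.swap.ae_enorm_uSlope_le

theorem exists_sphereDefect_le (h : IsClippedSolution c a b f) :
    ∃ K : ℝ≥0∞, K ≠ ∞ ∧ ∀ u v, sphereDefect c a b f u v ≤ K := by
  set K : ℝ := ‖c‖ + (∫ w, ‖a w‖) + (∫ w, ‖b w‖) + ∫ q, ‖f q‖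
  refine ⟨ENNReal.ofReal (K ^ 2 + 1), ENNReal.ofReal_ne_top, fun u v => ?_⟩
  rw [sphereDefect, ← ofReal_norm]
  refine ENNReal.ofReal_le_ofReal ?_
  have hw : ‖wave c a b f u v‖ ≤ K := by
    refine (norm_sub_le _ _).trans (add_le_add ((norm_add₃_le).trans (add_le_add (add_le_add le_rfl
      (norm_integral_Iic_le h.int_a u)) (norm_integral_Iic_le h.int_b v))) ?_)
    exact (norm_integral_le_integral_norm _).trans
      (setIntegral_le_integral h.int_f.norm (Eventually.of_forall fun _ => norm_nonneg _))
  rw [Real.norm_eq_abs, abs_le]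
  constructor <;> nlinarith [norm_nonneg (wave c a b f u v)]

theorem lintegral_defect_ne_top (h : IsClippedSolution c a b f) (hC : C ≠ ∞) :
    ∫⁻ q, defect C c a b f q ≠ ∞ := by
  obtain ⟨K, hK, hKle⟩ := h.exists_sphereDefect_le
  set A := ∫⁻ w, ‖a w‖ₑ
  set B := ∫⁻ w, ‖b w‖ₑ
  have hA : A ≠ ∞ := h.int_a.2.ne
  have hB : B ≠ ∞ := h.int_b.2.ne
  have hle : ∀ᵐ q : ℝ × ℝ, defect C c a b f q ≤
      C * ((1 + B + 1) + (1 + A + 1) + K) * (‖a q.1‖ₑ * ‖b q.2‖ₑ) := by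
    filter_upwards [ae_prod_of_ae_fst h.ae_enorm_uSlope_le, ae_prod_of_ae_snd h.ae_enorm_vSlope_le]
      with q hU hV
    have t1 : uExcess a f q.1 q.2 ≤ ‖a q.1‖ₑ * (1 + B) + ‖a q.1‖ₑ :=
      enorm_sub_le.trans (add_le_add (hU _) (enorm_clip_le _ _))
    have t2 : vExcess b f q.1 q.2 ≤ ‖b q.2‖ₑ * (1 + A) + ‖b q.2‖ₑ :=
      enorm_sub_le.trans (add_le_add (hV _) (enorm_clip_le _ _))
    calc _ ≤ C * (‖b q.2‖ₑ * (‖a q.1‖ₑ * (1 + B) + ‖a q.1‖ₑ) +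
          ‖a q.1‖ₑ * (‖b q.2‖ₑ * (1 + A) + ‖b q.2‖ₑ) + ‖a q.1‖ₑ * ‖b q.2‖ₑ * K) := by
          rw [defect]
          gcongr
          exact hKle _ _
      _ = _ := by ring
  have hfin : C * ((1 + B + 1) + (1 + A + 1) + K) ≠ ∞ := by
    simp [ENNReal.mul_eq_top, hC, hA, hB, hK]
  refine ne_top_of_le_ne_top ?_ (lintegral_mono_ae hle)
  rw [lintegral_const_mul' _ _ hfin, Measure.volume_eq_prod,
    lintegral_prod_mul h.meas_a.enorm.aemeasurable h.meas_b.enorm.aemeasurable]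
  exact ENNReal.mul_ne_top hfin (ENNReal.mul_ne_top hA hB)

variable [CompleteSpace E]

/-- Integration of `∂_u |P|² = 2⟨U, P⟩` from `u = -∞`, where `|P| = 1` by the data. -/
theorem sphereDefect_le (h : IsClippedSolution c a b f) (u v : ℝ) :
    sphereDefect c a b f u v ≤
      2 * ∫⁻ w in Iic u, ‖inner ℝ (uSlope a f w v) (wave c a b f w v)‖ₑ := by
  have iU := integrable_uSlope h.int_a h.int_f v
  have key := inner_primitive iU iU (c + ∫ z in Iic v, b z) (c + ∫ z in Iic v, b z) u
  simp only [← wave_eq_add_integral_uSlope h.int_a h.int_f] at key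
  rw [real_inner_self_eq_norm_sq, real_inner_self_eq_norm_sq, h.norm_v] at key
  rw [sphereDefect, key, one_pow, add_sub_cancel_left,
    ← lintegral_const_mul' _ _ (by norm_num : (2 : ℝ≥0∞) ≠ ∞)]
  refine (enorm_integral_le_lintegral_enorm _).trans (lintegral_mono fun w => ?_)
  rw [two_mul]
  exact enorm_add_le _ _

/-- The retracted source is a multiple of `P`, so `∂_v |U|² = -2⟨f, U⟩` is at most `2 ‖a‖ ‖b‖ |⟨U,
P⟩|`. The factor `‖a‖` cancels against `‖a‖ (‖U‖ - ‖a‖) ≤ ‖U‖² - ‖a‖²`. -/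
theorem ae_uExcess_le (h : IsClippedSolution c a b f) :
    ∀ᵐ u, ∀ v, uExcess a f u v ≤
      2 * ∫⁻ z in Iic v, ‖b z‖ₑ * ‖inner ℝ (uSlope a f u z) (wave c a b f u z)‖ₑ := by
  filter_upwards [ae_integrable_section h.int_f, ae_ae_of_ae h.eq, h.ae_enorm_uSlope_le]
    with u h2 h3 h4 v
  rcases le_or_gt ‖uSlope a f u v‖ ‖a u‖ with hle | hlt
  · rw [uExcess, clip_of_norm_le hle, sub_self, enorm_zero]; exact zero_le
  -- Where `a u = 0` the slope vanishes and has no excess; elsewhere the final division by `‖a u‖`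
  -- is legitimate.
  have ha : 0 < ‖a u‖ := by
    rcases eq_or_ne (a u) 0 with h0 | h0
    · have := h4 v
      rw [h0, enorm_zero, zero_mul, nonpos_iff_eq_zero, enorm_eq_zero] at this
      rw [this, norm_zero] at hlt
      exact absurd hlt (not_lt.2 (norm_nonneg _))
    · exact norm_pos_iff.2 h0
  have e : ∀ v, a u + ∫ x in Iic v, -f (u, x) = uSlope a f u v := fun v => by
    rw [integral_neg, uSlope, sub_eq_add_neg]
  have key := inner_primitive h2.neg h2.neg (a u) (a u) v
  simp only [Pi.neg_apply, e, real_inner_self_eq_norm_sq] at key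
  have bound : ‖‖uSlope a f u v‖ ^ 2 - ‖a u‖ ^ 2‖ₑ ≤ ‖a u‖ₑ *
      (2 * ∫⁻ z in Iic v, ‖b z‖ₑ * ‖inner ℝ (uSlope a f u z) (wave c a b f u z)‖ₑ) := by
    rw [key, add_sub_cancel_left, ← mul_assoc, ← lintegral_const_mul' _ _
      (ENNReal.mul_ne_top enorm_ne_top (by norm_num))]
    refine (enorm_integral_le_lintegral_enorm _).trans (lintegral_mono_ae (ae_restrict_of_ae ?_))
    filter_upwards [h3] with z hz
    obtain ⟨s, hs0, hs1, hs⟩ := exists_clip_eq_smul zero_le_one (wave c a b f u z)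
    have t : ‖inner ℝ (-f (u, z)) (uSlope a f u z)‖ₑ ≤
        ‖a u‖ₑ * (‖b z‖ₑ * ‖inner ℝ (uSlope a f u z) (wave c a b f u z)‖ₑ) := by
      rw [inner_neg_left, enorm_neg, hz, clippedSource, real_inner_smul_left, enorm_mul, hs,
        real_inner_smul_left, enorm_mul, real_inner_comm (uSlope a f u z) (wave c a b f u z),
        ← mul_assoc ‖a u‖ₑ]
      refine mul_le_mul' ((enorm_inner_le _ _).trans
        (mul_le_mul' (enorm_clip_le _ _) (enorm_clip_le _ _))) (mul_le_of_le_one_left zero_le ?_)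
      rw [Real.enorm_of_nonneg hs0]
      exact ENNReal.ofReal_le_one.2 hs1
    refine (enorm_add_le _ _).trans ((add_le_add t t).trans_eq ?_)
    ring
  have lower : ‖a u‖ₑ * uExcess a f u v ≤ ‖‖uSlope a f u v‖ ^ 2 - ‖a u‖ ^ 2‖ₑ := by
    rw [uExcess, ← ofReal_norm, ← ofReal_norm, ← ofReal_norm, norm_sub_clip (norm_nonneg _) hlt,
      ← ENNReal.ofReal_mul ha.le]
    refine ENNReal.ofReal_le_ofReal (le_trans ?_ (le_abs_self _))
    nlinarith
  exact (ENNReal.mul_le_mul_iff_right (by simpa using norm_pos_iff.1 ha) enorm_ne_top).1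
    (lower.trans bound)

theorem ae_inner_data_eq_zero (h : IsClippedSolution c a b f) :
    ∀ᵐ u, inner ℝ (a u) (c + ∫ w in Iic u, a w) = 0 := by
  filter_upwards [ae_hasDerivAt_integral_Iic h.int_a] with u hu
  have h1 := (hu.const_add c).inner ℝ (hu.const_add c)
  simp only [real_inner_self_eq_norm_sq, h.norm_u] at h1
  have h3 := h1.unique (hasDerivAt_const u ((1 : ℝ) ^ 2))
  rw [real_inner_comm] at h3
  linarith

/-- `⟨U, P⟩` starts from `⟨a, c + ∫ a⟩ = 0` at `v = -∞`, and `∂_v ⟨U, P⟩ = ⟨U, V⟩ - ⟨f, P⟩` would be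
zero if no retraction acted and `|P| = 1`. The defect measures the deviation. -/
theorem ae_enorm_inner_le (h : IsClippedSolution c a b f)
    (hC : 1 + (∫⁻ w, ‖a w‖ₑ) + ∫⁻ z, ‖b z‖ₑ ≤ C) :
    ∀ᵐ u, ∀ v, ‖inner ℝ (uSlope a f u v) (wave c a b f u v)‖ₑ ≤
      ∫⁻ z in Iic v, defect C c a b f (u, z) := by
  have hC1 : 1 ≤ C := le_self_add.trans (le_self_add.trans hC)
  filter_upwards [ae_integrable_section h.int_f, ae_ae_of_ae h.eq, h.ae_inner_data_eq_zero]
    with u h2 h3 h4 v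
  have e : ∀ v, a u + ∫ x in Iic v, -f (u, x) = uSlope a f u v := fun v => by
    rw [integral_neg, uSlope, sub_eq_add_neg]
  have key := inner_primitive h2.neg (integrable_vSlope h.int_b h.int_f u) (a u)
    (c + ∫ w in Iic u, a w) v
  simp only [Pi.neg_apply, e, h4, zero_add,
    ← wave_eq_add_integral_vSlope h.int_b h.int_f] at key
  rw [key]
  refine (enorm_integral_le_lintegral_enorm _).trans (lintegral_mono_ae (ae_restrict_of_ae ?_))
  filter_upwards [h3, h.ae_enorm_vSlope_le] with z hz hV
  set U := uSlope a f u z with hU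
  set V := vSlope b f u z with hVdef
  set P := wave c a b f u z with hP
  -- Each of the three errors is controlled by one summand of the defect. The first contains the
  -- unretracted `V`, whose bound `‖b‖ (1 + ∫ ‖a‖)` accounts for the size of `C`.
  have e1 : inner ℝ (-f (u, z)) P + inner ℝ V U = inner ℝ (U - clip ‖a u‖ U) V +
      inner ℝ (clip ‖a u‖ U) (V - clip ‖b z‖ V) +
      inner ℝ (clip ‖a u‖ U) (clip ‖b z‖ V) * (1 - inner ℝ (clip 1 P) P) := by
    rw [hz, clippedSource, inner_neg_left, real_inner_smul_left, inner_sub_left, inner_sub_right,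
      real_inner_comm U V]
    ring
  rw [e1]
  have t1 : ‖inner ℝ (U - clip ‖a u‖ U) V‖ₑ ≤ C * (‖b z‖ₑ * uExcess a f u z) := by
    refine (enorm_inner_le _ _).trans ?_
    calc _ ≤ uExcess a f u z * (‖b z‖ₑ * C) := by
          refine mul_le_mul' le_rfl ((hV u).trans ?_)
          gcongr
          exact le_self_add.trans hC
      _ = _ := by ring
  have t2 : ‖inner ℝ (clip ‖a u‖ U) (V - clip ‖b z‖ V)‖ₑ ≤ C * (‖a u‖ₑ * vExcess b f u z) := by
    refine (enorm_inner_le _ _).trans (le_trans ?_ (le_mul_of_one_le_left zero_le hC1))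
    exact mul_le_mul' (enorm_clip_le _ _) le_rfl
  have t3 : ‖inner ℝ (clip ‖a u‖ U) (clip ‖b z‖ V) * (1 - inner ℝ (clip 1 P) P)‖ₑ ≤
      C * (‖a u‖ₑ * ‖b z‖ₑ * sphereDefect c a b f u z) := by
    refine le_trans ?_ (le_mul_of_one_le_left zero_le hC1)
    rw [enorm_mul]
    refine mul_le_mul' ((enorm_inner_le _ _).trans
      (mul_le_mul' (enorm_clip_le _ _) (enorm_clip_le _ _))) ?_
    rw [sphereDefect, ← ofReal_norm, ← ofReal_norm]
    exact ENNReal.ofReal_le_ofReal (abs_one_sub_inner_clip_le P)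
  refine (enorm_add_le _ _).trans ((add_le_add ((enorm_add_le _ _).trans
    (add_le_add t1 t2)) t3).trans_eq ?_)
  simp only [defect]
  ring

theorem ae_uExcess_le_vVolterra (h : IsClippedSolution c a b f)
    (hC : 1 + (∫⁻ w, ‖a w‖ₑ) + ∫⁻ z, ‖b z‖ₑ ≤ C) :
    ∀ᵐ u, ∀ v, ‖b v‖ₑ * uExcess a f u v ≤
      2 * vVolterra (fun v => ‖b v‖ₑ) (vVolterra (fun v => ‖b v‖ₑ) (defect C c a b f)) (u, v) := by
  filter_upwards [h.ae_uExcess_le, h.ae_enorm_inner_le hC] with u h1 h2 v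
  calc _ ≤ ‖b v‖ₑ * (2 * ∫⁻ z in Iic v, ‖b z‖ₑ * ∫⁻ y in Iic z, defect C c a b f (u, y)) := by
        gcongr
        refine (h1 v).trans ?_
        gcongr with z
        exact h2 z
    _ = _ := by simp only [vVolterra]; ring

theorem ae_vExcess_le_uVolterra (h : IsClippedSolution c a b f)
    (hC : 1 + (∫⁻ w, ‖a w‖ₑ) + ∫⁻ z, ‖b z‖ₑ ≤ C) :
    ∀ᵐ v, ∀ u, ‖a u‖ₑ * vExcess b f u v ≤
      2 * uVolterra (fun u => ‖a u‖ₑ) (uVolterra (fun u => ‖a u‖ₑ) (defect C c a b f)) (u, v) := by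
  filter_upwards [h.swap.ae_uExcess_le_vVolterra (C := C) (by rwa [add_right_comm])] with v hv u
  have := hv u
  simp only [vVolterra, defect_swap] at this
  exact this

theorem sphereDefect_le_uVolterra (h : IsClippedSolution c a b f)
    (hC : 1 + (∫⁻ w, ‖a w‖ₑ) + ∫⁻ z, ‖b z‖ₑ ≤ C) (u v : ℝ) :
    ‖a u‖ₑ * ‖b v‖ₑ * sphereDefect c a b f u v ≤ 2 * uVolterra (fun u => ‖a u‖ₑ)
      (vVolterra (fun v => ‖b v‖ₑ) (defect C c a b f)) (u, v) := by
  rw [uVolterra_vVolterra_apply (h.measurable_defect C)]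
  calc _ ≤ ‖a u‖ₑ * ‖b v‖ₑ * (2 * ∫⁻ w in Iic u, ∫⁻ z in Iic v, defect C c a b f (w, z)) := by
        gcongr
        refine (h.sphereDefect_le u v).trans
          (mul_le_mul' le_rfl (lintegral_mono_ae (ae_restrict_of_ae ?_)))
        filter_upwards [h.ae_enorm_inner_le hC] with w hw
        exact hw v
    _ = _ := by ring

/-- Every summand of the defect is bounded by a twofold Volterra integral of the defect. In the
weighted norm this reads `k² N ≤ 6 C N` with `N` finite, so `N = 0` for large `k`. -/
theorem ae_defect_eq_zero (h : IsClippedSolution c a b f) (hC' : C ≠ ∞)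
    (hC : 1 + (∫⁻ w, ‖a w‖ₑ) + ∫⁻ z, ‖b z‖ₑ ≤ C) : ∀ᵐ q, defect C c a b f q = 0 := by
  set α : ℝ → ℝ≥0∞ := fun u => ‖a u‖ₑ with hα
  set β : ℝ → ℝ≥0∞ := fun u => ‖b u‖ₑ with hβ
  set R := defect C c a b f with hR
  have mα : Measurable α := h.meas_a.enorm
  have mβ : Measurable β := h.meas_b.enorm
  have fα : ∫⁻ u, α u ≠ ∞ := h.int_a.2.ne
  have fβ : ∫⁻ u, β u ≠ ∞ := h.int_b.2.ne
  have mR : Measurable R := h.measurable_defect C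
  have hC1 : 1 ≤ C := le_self_add.trans (le_self_add.trans hC)
  -- Any `k` with `k² > 6 C` would serve; here `k² ≥ 12 C` because `C ≥ 1`.
  set k : ℝ≥0∞ := 12 * C with hkdef
  have hk : k ≠ ∞ := ENNReal.mul_ne_top (by norm_num) hC'
  have mW := measurable_planeWeight hk mα fα mβ fβ
  have m1 := measurable_vVolterra mβ mR
  have m2 := measurable_uVolterra mα mR
  have i1 := (mul_le_mul_right (lintegral_planeWeight_vVolterra_le hk mα fα mβ fβ m1) k).trans
    (lintegral_planeWeight_vVolterra_le hk mα fα mβ fβ mR)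
  have i2 := (mul_le_mul_right (lintegral_planeWeight_uVolterra_le hk mα fα mβ fβ m2) k).trans
    (lintegral_planeWeight_uVolterra_le hk mα fα mβ fβ mR)
  have i3 := lintegral_planeWeight_uVolterra_vVolterra_le hk mα fα mβ fβ mR
  rw [← mul_assoc] at i1 i2
  have hle : ∀ᵐ q, R q ≤ 2 * C * (vVolterra β (vVolterra β R) q + uVolterra α (uVolterra α R) q +
      uVolterra α (vVolterra β R) q) := by
    filter_upwards [ae_prod_of_ae_fst (h.ae_uExcess_le_vVolterra hC),
      ae_prod_of_ae_snd (h.ae_vExcess_le_uVolterra hC)] with ⟨u, v⟩ h1 h2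
    have h3 := h.sphereDefect_le_uVolterra hC u v
    calc R (u, v) ≤ C * (_ + _ + _) := mul_le_mul' le_rfl (add_le_add (add_le_add (h1 v) (h2 u)) h3)
      _ = _ := by ring
  set N := ∫⁻ q, planeWeight k α β q * R q with hN
  have w1 : Measurable fun q => planeWeight k α β q * vVolterra β (vVolterra β R) q :=
    mW.mul (measurable_vVolterra mβ m1)
  have w2 : Measurable fun q => planeWeight k α β q * vVolterra β (vVolterra β R) q +
      planeWeight k α β q * uVolterra α (uVolterra α R) q :=
    w1.add (mW.mul (measurable_uVolterra mα m2))
  have hNle : N ≤ 2 * C * ((∫⁻ q, planeWeight k α β q * vVolterra β (vVolterra β R) q) +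
      (∫⁻ q, planeWeight k α β q * uVolterra α (uVolterra α R) q) +
      ∫⁻ q, planeWeight k α β q * uVolterra α (vVolterra β R) q) := by
    rw [← lintegral_add_left w1, ← lintegral_add_left w2,
      ← lintegral_const_mul' _ _ (ENNReal.mul_ne_top (by norm_num) hC')]
    refine lintegral_mono_ae ?_
    filter_upwards [hle] with q hq
    calc _ ≤ planeWeight k α β q * _ := mul_le_mul' le_rfl hq
      _ = _ := by ring
  have hNfin : N ≠ ∞ := by
    refine ne_top_of_le_ne_top (h.lintegral_defect_ne_top hC') (lintegral_mono fun q => ?_)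
    exact mul_le_of_le_one_left zero_le (planeWeight_le_one q)
  have hN0 : N = 0 := by
    by_contra hne
    set I₁ := ∫⁻ q, planeWeight k α β q * vVolterra β (vVolterra β R) q
    set I₂ := ∫⁻ q, planeWeight k α β q * uVolterra α (uVolterra α R) q
    set I₃ := ∫⁻ q, planeWeight k α β q * uVolterra α (vVolterra β R) q
    have t : k * k * N ≤ 2 * C * (N + N + N) := by
      calc k * k * N ≤ k * k * (2 * C * (I₁ + I₂ + I₃)) := mul_le_mul' le_rfl hNle
        _ = 2 * C * (k * k * I₁ + k * k * I₂ + k * k * I₃) := by ring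
        _ ≤ 2 * C * (N + N + N) := by
          gcongr
    have t' : 12 * C * N ≤ 6 * C * N := by
      calc 12 * C * N ≤ k * k * N := by
            refine mul_le_mul' ?_ le_rfl
            rw [← hkdef]
            refine le_mul_of_one_le_left zero_le (hC1.trans ?_)
            exact le_mul_of_one_le_left zero_le (by norm_num)
        _ ≤ 2 * C * (N + N + N) := t
        _ = 6 * C * N := by ring
    have hC0 : C ≠ 0 := (zero_lt_one.trans_le hC1).ne'
    have := (ENNReal.mul_le_mul_iff_left hne hNfin).1 t'
    have := (ENNReal.mul_le_mul_iff_left hC0 hC').1 this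
    norm_num at this
  have mWR : Measurable fun q => planeWeight k α β q * R q := mW.mul mR
  rw [hN, lintegral_eq_zero_iff mWR] at hN0
  filter_upwards [hN0] with q hq
  refine (mul_eq_zero.1 hq).resolve_left fun h0 => ?_
  have := exp_le_planeWeight hk mα mβ (M := (∫⁻ u, α u) + ∫⁻ u, β u)
    (ENNReal.add_ne_top.2 ⟨fα, fβ⟩) le_self_add le_add_self q
  rw [h0, nonpos_iff_eq_zero] at this
  exact mul_ne_zero (by simp [Real.exp_pos]) (by simp [Real.exp_pos]) this

theorem isSolution (h : IsClippedSolution c a b f) : IsSolution c a b f := by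
  set C : ℝ≥0∞ := 1 + (∫⁻ w, ‖a w‖ₑ) + ∫⁻ z, ‖b z‖ₑ with hC
  have hC' : C ≠ ∞ := by
    have h1 : ∫⁻ w, ‖a w‖ₑ ≠ ∞ := h.int_a.2.ne
    have h2 : ∫⁻ w, ‖b w‖ₑ ≠ ∞ := h.int_b.2.ne
    simp [hC, h1, h2]
  have hR := h.ae_defect_eq_zero hC' le_rfl
  -- The factors `‖a‖`, `‖b‖` in the defect hide the constraints where they vanish, so these are
  -- recovered from `⟨U, P⟩ = 0` through the preceding estimates.
  have hp : ∀ᵐ u, ∀ v, inner ℝ (uSlope a f u v) (wave c a b f u v) = 0 := by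
    filter_upwards [h.ae_enorm_inner_le (C := C) le_rfl, ae_ae_of_ae hR] with u h1 h2 v
    have h3 := h1 v
    rw [lintegral_congr_ae (ae_restrict_of_ae h2), lintegral_zero, nonpos_iff_eq_zero,
      enorm_eq_zero] at h3
    exact h3
  have hU : ∀ {a b : ℝ → E} {f : ℝ × ℝ → E}, IsClippedSolution c a b f →
      (∀ᵐ u, ∀ v, inner ℝ (uSlope a f u v) (wave c a b f u v) = 0) →
      ∀ᵐ u, ∀ v, clip ‖a u‖ (uSlope a f u v) = uSlope a f u v := by
    intro a b f h hp
    filter_upwards [h.ae_uExcess_le, hp] with u h1 h2 v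
    have h3 := h1 v
    simp only [h2, enorm_zero, mul_zero, lintegral_zero, nonpos_iff_eq_zero] at h3
    rw [uExcess, enorm_eq_zero, sub_eq_zero] at h3
    exact h3.symm
  have hnorm : ∀ u v, ‖wave c a b f u v‖ = 1 := by
    intro u v
    have h1 := h.sphereDefect_le u v
    have h2 : ∀ᵐ w, ‖inner ℝ (uSlope a f w v) (wave c a b f w v)‖ₑ = 0 := by
      filter_upwards [hp] with w hw
      rw [hw v, enorm_zero]
    rw [lintegral_congr_ae (ae_restrict_of_ae h2), lintegral_zero, mul_zero, nonpos_iff_eq_zero,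
      sphereDefect, enorm_eq_zero, sub_eq_zero] at h1
    exact (pow_eq_one_iff_of_nonneg (norm_nonneg _) two_ne_zero).1 h1
  have hp' : ∀ᵐ v, ∀ u, inner ℝ (vSlope b f u v) (wave c a b f u v) = 0 := by
    filter_upwards [h.swap.ae_enorm_inner_le (C := C) (by rw [hC, add_right_comm]),
      ae_ae_of_ae (ae_swap hR)] with v h1 h2 u
    have h3 := h1 u
    simp only [defect_swap] at h3
    rw [lintegral_congr_ae (ae_restrict_of_ae h2), lintegral_zero, nonpos_iff_eq_zero,
      enorm_eq_zero, wave_swap] at h3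
    exact h3
  have hV := hU h.swap (by simpa only [wave_swap, uSlope_swap] using hp')
  refine ⟨h.meas_a, h.meas_b, h.meas_f, h.int_a, h.int_b, h.int_f, hnorm, ?_⟩
  filter_upwards [h.eq, ae_prod_of_ae_fst (hU h hp), ae_prod_of_ae_snd hV] with q h1 h2 h3
  rw [h1, clippedSource, h2 q.2, clip_of_norm_le (hnorm _ _).le]
  have h4 := h3 q.1
  rw [uSlope_swap] at h4
  rw [h4]

end IsClippedSolution

theorem exists_isSolution [CompleteSpace E] (ha : StronglyMeasurable a) (ha' : Integrable a)
    (hb : StronglyMeasurable b) (hb' : Integrable b) (hu : ∀ u, ‖c + ∫ w in Iic u, a w‖ = 1)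
    (hv : ∀ v, ‖c + ∫ z in Iic v, b z‖ = 1) : ∃ f, IsSolution c a b f := by
  obtain ⟨f, mf, hf, e⟩ := exists_eq_clippedSource c ha ha' hb hb'
  exact ⟨f, IsClippedSolution.isSolution ⟨ha, hb, mf, ha', hb', hf, hu, hv, e⟩⟩

end Excess

/-! ### Boundary data extended to the line -/

section Data

variable {d : ℕ} {s₀ : ℝ} {γ : ℝ → Space d}

/-- The derivative of data on `[0, s₀]`, extended by zero to the real line. -/
noncomputable def dataDeriv (s₀ : ℝ) (γ : ℝ → Space d) : ℝ → Space d :=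
  (Ioc 0 s₀).indicator (deriv γ)

theorem stronglyMeasurable_dataDeriv : StronglyMeasurable (dataDeriv s₀ γ) :=
  (stronglyMeasurable_deriv γ).indicator measurableSet_Ioc

namespace IsData

/-- Coordinates reduce differentiability and the fundamental theorem to real-valued absolutely
continuous functions. -/
theorem abs_cont_apply (h : IsData s₀ γ) (i : Fin (d + 1)) :
    AbsolutelyContinuousOnInterval (fun s => γ s i) 0 s₀ :=
  absolutelyContinuous_of_dist_le h.abs_cont fun x _ y _ => by
    rw [dist_eq_norm, dist_eq_norm]
    exact PiLp.norm_apply_le (γ x - γ y) i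

theorem ae_hasDerivAt (h : IsData s₀ γ) :
    ∀ᵐ s, s ∈ uIcc 0 s₀ → HasDerivAt γ (deriv γ s) s := by
  filter_upwards [ae_all_iff.2 fun i => (h.abs_cont_apply i).ae_differentiableAt] with s hs hmem
  exact (differentiableAt_euclidean.2 fun i => hs i hmem).hasDerivAt

theorem ae_deriv_apply (h : IsData s₀ γ) (i : Fin (d + 1)) :
    ∀ᵐ s, s ∈ uIcc 0 s₀ → deriv γ s i = deriv (fun t => γ t i) s := by
  filter_upwards [h.ae_hasDerivAt] with s hs hmem
  exact (((EuclideanSpace.proj (𝕜 := ℝ) i).hasFDerivAt.comp_hasDerivAt s (hs hmem)).deriv).symm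

theorem integrableOn_deriv (h : IsData s₀ γ) (h₀ : 0 < s₀) : IntegrableOn (deriv γ) (Ioc 0 s₀) := by
  refine Integrable.of_eval_piLp fun i => ?_
  have h1 := (h.abs_cont_apply i).intervalIntegrable_deriv
  rw [intervalIntegrable_iff_integrableOn_Ioc_of_le h₀.le] at h1
  refine h1.congr ((ae_restrict_iff' measurableSet_Ioc).2 ?_)
  filter_upwards [h.ae_deriv_apply i] with s hs hmem
  exact (hs (by rw [uIcc_of_le h₀.le]; exact Ioc_subset_Icc_self hmem)).symm

theorem integrable_dataDeriv (h : IsData s₀ γ) (h₀ : 0 < s₀) : Integrable (dataDeriv s₀ γ) :=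
  (integrable_indicator_iff measurableSet_Ioc).2 (h.integrableOn_deriv h₀)

theorem setIntegral_deriv (h : IsData s₀ γ) (h₀ : 0 < s₀) {s : ℝ} (hs : s ∈ Icc 0 s₀) :
    ∫ t in Ioc 0 s, deriv γ t = γ s - γ 0 := by
  have hI := (h.integrableOn_deriv h₀).mono_set (Ioc_subset_Ioc_right hs.2)
  ext i
  rw [eval_integral_piLp fun i => hI.eval_piLp i]
  have hac := (h.abs_cont_apply i).mono (c := 0) (d := s)
    (by rw [uIcc_of_le hs.1, uIcc_of_le h₀.le]; exact Icc_subset_Icc_right hs.2)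
  have := hac.integral_deriv_eq_sub
  rw [intervalIntegral.integral_of_le hs.1] at this
  rw [PiLp.sub_apply, ← this]
  refine setIntegral_congr_ae measurableSet_Ioc ?_
  filter_upwards [h.ae_deriv_apply i] with t ht hmem
  exact ht (by rw [uIcc_of_le h₀.le]; exact ⟨hmem.1.le, hmem.2.trans hs.2⟩)

end IsData

theorem clamp_mem (h₀ : 0 < s₀) (s : ℝ) : max 0 (min s s₀) ∈ Icc 0 s₀ :=
  ⟨le_max_left _ _, max_le h₀.le (min_le_right _ _)⟩

theorem clamp_of_mem {s : ℝ} (hs : s ∈ Icc 0 s₀) : max 0 (min s s₀) = s := by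
  rw [min_eq_left hs.2, max_eq_right hs.1]

theorem Ioc_inter_Iic_clamp (s₀ s : ℝ) : Ioc 0 s₀ ∩ Iic s = Ioc 0 (max 0 (min s s₀)) := by
  ext x
  simp only [mem_inter_iff, mem_Ioc, mem_Iic, le_max_iff, le_min_iff]
  grind

/-- Extending the derivative by zero extends the data by constants, so the extension stays on the
sphere. -/
theorem IsData.integral_Iic_dataDeriv (h : IsData s₀ γ) (h₀ : 0 < s₀) (s : ℝ) :
    ∫ t in Iic s, dataDeriv s₀ γ t = γ (max 0 (min s s₀)) - γ 0 := by
  rw [dataDeriv, setIntegral_indicator measurableSet_Ioc, inter_comm, Ioc_inter_Iic_clamp,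
    h.setIntegral_deriv h₀ (clamp_mem h₀ s)]

theorem IsData.norm_add_integral (h : IsData s₀ γ) (h₀ : 0 < s₀) (s : ℝ) :
    ‖γ 0 + ∫ t in Iic s, dataDeriv s₀ γ t‖ = 1 := by
  rw [h.integral_Iic_dataDeriv h₀, add_sub_cancel]
  simpa using h.mem_sphere _ (clamp_mem h₀ s)

end Data

/-! ### The rectangle up to null sets -/

section Rectangle

variable {E : Type*} [NormedAddCommGroup E] [NormedSpace ℝ E] {u₀ v₀ : ℝ}

theorem rect_ae_eq (u₀ v₀ : ℝ) : (Ioc 0 u₀ ×ˢ Ioc 0 v₀ : Set (ℝ × ℝ)) =ᵐ[volume] rect u₀ v₀ := by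
  rw [Measure.volume_eq_prod]
  exact Measure.set_prod_ae_eq Ioc_ae_eq_Icc Ioc_ae_eq_Icc

theorem ae_rect_iff {p : ℝ × ℝ → Prop} : (∀ᵐ q ∂(volume.restrict (rect u₀ v₀)), p q) ↔
    ∀ᵐ q : ℝ × ℝ, q.1 ∈ Ioo 0 u₀ → q.2 ∈ Ioo 0 v₀ → p q := by
  have h : (Ioo 0 u₀ ×ˢ Ioo 0 v₀ : Set (ℝ × ℝ)) =ᵐ[volume] rect u₀ v₀ := by
    rw [Measure.volume_eq_prod]
    exact Measure.set_prod_ae_eq Ioo_ae_eq_Icc Ioo_ae_eq_Icc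
  rw [← Measure.restrict_congr_set h, ae_restrict_iff' (measurableSet_Ioo.prod measurableSet_Ioo)]
  simp only [mem_prod, and_imp]

theorem ae_Icc_iff {s₀ : ℝ} {p : ℝ → Prop} : (∀ᵐ s ∂(volume.restrict (Icc 0 s₀)), p s) ↔
    ∀ᵐ s, s ∈ Ioo 0 s₀ → p s := by
  rw [← Measure.restrict_congr_set Ioo_ae_eq_Icc, ae_restrict_iff' measurableSet_Ioo]

theorem setIntegral_Iic_prod_indicator {S : ℝ × ℝ → E} (hS : IntegrableOn S (rect u₀ v₀))
    (u v : ℝ) : ∫ q in Iic u ×ˢ Iic v, (Ioc 0 u₀ ×ˢ Ioc 0 v₀).indicator S q =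
      ∫ w in (0 : ℝ)..max 0 (min u u₀), ∫ z in (0 : ℝ)..max 0 (min v v₀), S (w, z) := by
  have hS' : IntegrableOn S (Ioc 0 u₀ ×ˢ Ioc 0 v₀) := hS.congr_set_ae (rect_ae_eq u₀ v₀)
  rw [setIntegral_indicator (measurableSet_Ioc.prod measurableSet_Ioc), prod_inter_prod,
    inter_comm (Iic u), inter_comm (Iic v), Ioc_inter_Iic_clamp, Ioc_inter_Iic_clamp]
  have hS2 : IntegrableOn S (Ioc 0 (max 0 (min u u₀)) ×ˢ Ioc 0 (max 0 (min v v₀))) := by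
    rw [← Ioc_inter_Iic_clamp, ← Ioc_inter_Iic_clamp]
    exact hS'.mono_set (prod_mono inter_subset_left inter_subset_left)
  rw [Measure.volume_eq_prod] at hS2 ⊢
  rw [setIntegral_prod S hS2, intervalIntegral.integral_of_le (le_max_left _ _)]
  simp_rw [intervalIntegral.integral_of_le (le_max_left 0 (min v v₀))]

end Rectangle

/-! ### Slopes of a map that agrees with a wave on the rectangle -/

section Restriction

variable {E : Type*} [NormedAddCommGroup E] [InnerProductSpace ℝ E] [CompleteSpace E]
  {u₀ v₀ : ℝ} {c : E} {a b : ℝ → E} {f : ℝ × ℝ → E} {ψ : ℝ → ℝ → E}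

/-- For interior `u` the derivative sees only values on the rectangle, while `v` may lie on its
edge, as (iii) requires. -/
theorem ae_hasDerivAt_of_eq_wave
    (hψ : ∀ u ∈ Icc 0 u₀, ∀ v ∈ Icc 0 v₀, ψ u v = wave c a b f u v)
    (ha : Integrable a) (hf : Integrable f) :
    ∀ᵐ u, u ∈ Ioo 0 u₀ → ∀ v ∈ Icc 0 v₀, HasDerivAt (fun w => ψ w v) (uSlope a f u v) u := by
  filter_upwards [ae_forall_hasDerivAt_wave (c := c) (b := b) ha hf] with u hu hmem v hv
  refine (hu v).congr_of_eventuallyEq ?_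
  filter_upwards [Ioo_mem_nhds hmem.1 hmem.2] with w hw
  exact hψ w (Ioo_subset_Icc_self hw) v hv

theorem ae_hasDerivAt_of_eq_wave_right
    (hψ : ∀ u ∈ Icc 0 u₀, ∀ v ∈ Icc 0 v₀, ψ u v = wave c a b f u v)
    (hb : Integrable b) (hf : Integrable f) :
    ∀ᵐ v, v ∈ Ioo 0 v₀ → ∀ u ∈ Icc 0 u₀, HasDerivAt (fun z => ψ u z) (vSlope b f u v) v := by
  filter_upwards [ae_forall_hasDerivAt_wave_right (c := c) (a := a) hb hf] with v hv hmem u hu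
  refine (hv u).congr_of_eventuallyEq ?_
  filter_upwards [Ioo_mem_nhds hmem.1 hmem.2] with w hw
  exact hψ u hu w (Ioo_subset_Icc_self hw)

end Restriction

/-! ### Equivalence with the integral formulation -/

section WaveMaps

variable {d : ℕ} {u₀ v₀ : ℝ} {c : Space d} {a b : ℝ → Space d} {f : ℝ × ℝ → Space d}
  {ψ : ℝ → ℝ → Space d} {φp φm : ℝ → Space d}

theorem ae_hasMixed_of_eq_wave
    (hψ : ∀ u ∈ Icc 0 u₀, ∀ v ∈ Icc 0 v₀, ψ u v = wave c a b f u v)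
    (hb : Integrable b) (hf : Integrable f) (mf : StronglyMeasurable f) :
    ∀ᵐ q ∂(volume.restrict (rect u₀ v₀)), HasMixed ψ q.1 q.2 ∧ dudv ψ q.1 q.2 = -f q := by
  rw [ae_rect_iff]
  filter_upwards [ae_prod_of_ae_snd (ae_hasDerivAt_of_eq_wave_right hψ hb hf),
    ae_hasDerivAt_section hf mf] with q h1 h2 hu hv
  have hev : ∀ᶠ w in 𝓝 q.1, HasDerivAt (fun z => ψ w z) (vSlope b f w q.2) q.2 := by
    filter_upwards [Ioo_mem_nhds hu.1 hu.2] with w hw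
    exact h1 hv w (Ioo_subset_Icc_self hw)
  have hd : HasDerivAt (fun w => dv ψ w q.2) (-f q) q.1 := by
    have h3 : HasDerivAt (fun w => vSlope b f w q.2) (-f q) q.1 := h2.const_sub (b q.2)
    refine h3.congr_of_eventuallyEq ?_
    filter_upwards [hev] with w hw
    exact hw.deriv
  exact ⟨⟨hev.mono fun w hw => hw.differentiableAt, hd.differentiableAt⟩, hd.deriv⟩

/-- Off the rectangle one of the data derivatives is zero; by conservation so is the corresponding
slope, and with it the source. -/
theorem IsSolution.ae_eq_zero_of_notMem
    (h : IsSolution c (dataDeriv u₀ φp) (dataDeriv v₀ φm) f) :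
    ∀ᵐ q : ℝ × ℝ, q ∉ Ioc 0 u₀ ×ˢ Ioc 0 v₀ → f q = 0 := by
  filter_upwards [h.eq, ae_prod_of_ae_fst h.ae_norm_uSlope, ae_prod_of_ae_snd h.ae_norm_vSlope]
    with q e hU hV hq
  have hU' := hU q.2
  have hV' := hV q.1
  rw [e]
  rw [mem_prod, not_and_or] at hq
  rcases hq with hq | hq
  · have h0 : dataDeriv u₀ φp q.1 = 0 := indicator_of_notMem hq _
    rw [h0, norm_zero, norm_eq_zero] at hU'
    rw [hU', inner_zero_left, zero_smul]
  · have h0 : dataDeriv v₀ φm q.2 = 0 := indicator_of_notMem hq _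
    rw [h0, norm_zero, norm_eq_zero] at hV'
    rw [hV', inner_zero_right, zero_smul]

theorem IsSolution.ae_source_eq (h : IsSolution c a b f)
    (hψ : ∀ u ∈ Icc 0 u₀, ∀ v ∈ Icc 0 v₀, ψ u v = wave c a b f u v) :
    ∀ᵐ q ∂(volume.restrict (rect u₀ v₀)), inner ℝ (du ψ q.1 q.2) (dv ψ q.1 q.2) • ψ q.1 q.2 =
      f q := by
  rw [ae_rect_iff]
  filter_upwards [h.eq, ae_prod_of_ae_fst (ae_hasDerivAt_of_eq_wave hψ h.int_a h.int_f),
    ae_prod_of_ae_snd (ae_hasDerivAt_of_eq_wave_right hψ h.int_b h.int_f)] with q e h1 h2 hu hv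
  have hu' := Ioo_subset_Icc_self hu
  have hv' := Ioo_subset_Icc_self hv
  rw [e, du, dv, (h1 hu q.2 hv').deriv, (h2 hv q.1 hu').deriv, hψ q.1 hu' q.2 hv']

theorem IsSolution.isWaveMap (hu₀ : 0 < u₀) (hv₀ : 0 < v₀) (hφp : IsData u₀ φp)
    (hφm : IsData v₀ φm) (h0 : φp 0 = φm 0)
    (h : IsSolution (φp 0) (dataDeriv u₀ φp) (dataDeriv v₀ φm) f) :
    IsWaveMap u₀ v₀ φp φm (wave (φp 0) (dataDeriv u₀ φp) (dataDeriv v₀ φm) f) := by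
  set ψ := wave (φp 0) (dataDeriv u₀ φp) (dataDeriv v₀ φm) f with hψdef
  have hψ : ∀ u ∈ Icc 0 u₀, ∀ v ∈ Icc 0 v₀,
    ψ u v = wave (φp 0) (dataDeriv u₀ φp) (dataDeriv v₀ φm) f u v := fun _ _ _ _ => rfl
  have hsrc := h.ae_source_eq hψ
  have hint : IntegrableOn (fun p : ℝ × ℝ => inner ℝ (du ψ p.1 p.2) (dv ψ p.1 p.2) • ψ p.1 p.2)
      (rect u₀ v₀) := h.int_f.integrableOn.congr (hsrc.mono fun q hq => hq.symm)
  refine ⟨fun u _ v _ => by simpa using h.norm_wave u v, ?_, ?_, ?_, hint, fun u hu v hv => ?_⟩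
  · rw [ae_rect_iff]
    filter_upwards [ae_prod_of_ae_fst (ae_hasDerivAt_of_eq_wave hψ h.int_a h.int_f)]
      with q h1 hu hv
    exact (h1 hu _ (Ioo_subset_Icc_self hv)).differentiableAt
  · rw [ae_rect_iff]
    filter_upwards [ae_prod_of_ae_snd (ae_hasDerivAt_of_eq_wave_right hψ h.int_b h.int_f)]
      with q h1 hu hv
    exact (h1 hv _ (Ioo_subset_Icc_self hu)).differentiableAt
  · have mw : StronglyMeasurable fun q : ℝ × ℝ => ψ q.1 q.2 :=
      stronglyMeasurable_wave h.meas_a h.int_a h.int_b h.meas_f h.int_f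
    have hi : Integrable fun q : ℝ × ℝ => inner ℝ (f q) (ψ q.1 q.2) := by
      refine h.int_f.norm.mono' (h.meas_f.inner mw).aestronglyMeasurable
        (Eventually.of_forall fun q => ?_)
      refine (norm_inner_le_norm _ _).trans (le_of_eq ?_)
      rw [h.norm_wave, mul_one]
    refine hi.integrableOn.congr (hsrc.mono fun q hq => ?_)
    simp only
    rw [← hq, real_inner_smul_left, real_inner_self_eq_norm_sq, h.norm_wave]
    ring
  · have hS := setIntegral_Iic_prod_indicator hint u v
    rw [clamp_of_mem hu, clamp_of_mem hv] at hS
    rw [← hS, hψdef, wave, hφp.integral_Iic_dataDeriv hu₀, hφm.integral_Iic_dataDeriv hv₀,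
      clamp_of_mem hu, clamp_of_mem hv, ← h0]
    have hfi : ∫ q in Iic u ×ˢ Iic v, f q = ∫ q in Iic u ×ˢ Iic v,
        (Ioc 0 u₀ ×ˢ Ioc 0 v₀).indicator
          (fun p : ℝ × ℝ => inner ℝ (du ψ p.1 p.2) (dv ψ p.1 p.2) • ψ p.1 p.2) q := by
      refine integral_congr_ae (ae_restrict_of_ae ?_)
      rw [← Measure.restrict_congr_set (rect_ae_eq u₀ v₀),
        ae_restrict_iff' (measurableSet_Ioc.prod measurableSet_Ioc)] at hsrc
      filter_upwards [hsrc, h.ae_eq_zero_of_notMem] with q h1 h2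
      by_cases hq : q ∈ Ioc 0 u₀ ×ˢ Ioc 0 v₀
      · rw [indicator_of_mem hq, h1 hq]
      · rw [indicator_of_notMem hq, h2 hq]
    rw [hfi]
    abel

/-- The source of `ψ`, extended by zero, generates the continuation of `ψ` by clamping both
variables to the rectangle, which takes values in the sphere on the whole plane. -/
theorem IsWaveMap.exists_isSolution (hu₀ : 0 < u₀) (hv₀ : 0 < v₀) (hφp : IsData u₀ φp)
    (hφm : IsData v₀ φm) (h0 : φp 0 = φm 0) (h : IsWaveMap u₀ v₀ φp φm ψ) :
    ∃ f, IsSolution (φp 0) (dataDeriv u₀ φp) (dataDeriv v₀ φm) f ∧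
      ∀ u ∈ Icc 0 u₀, ∀ v ∈ Icc 0 v₀,
        ψ u v = wave (φp 0) (dataDeriv u₀ φp) (dataDeriv v₀ φm) f u v := by
  set S : ℝ × ℝ → Space d := fun p => inner ℝ (du ψ p.1 p.2) (dv ψ p.1 p.2) • ψ p.1 p.2 with hS
  have hI : Integrable ((Ioc 0 u₀ ×ˢ Ioc 0 v₀).indicator S) :=
    (integrable_indicator_iff (measurableSet_Ioc.prod measurableSet_Ioc)).2
      (IntegrableOn.congr_set_ae h.integrable_source (rect_ae_eq u₀ v₀))
  obtain ⟨f, mf, hf⟩ := hI.1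
  have intf : Integrable f := hI.congr hf
  have ia := hφp.integrable_dataDeriv hu₀
  have ib := hφm.integrable_dataDeriv hv₀
  have hw : ∀ u v, wave (φp 0) (dataDeriv u₀ φp) (dataDeriv v₀ φm) f u v =
      ψ (max 0 (min u u₀)) (max 0 (min v v₀)) := by
    intro u v
    rw [h.duhamel _ (clamp_mem hu₀ u) _ (clamp_mem hv₀ v), wave, hφp.integral_Iic_dataDeriv hu₀,
      hφm.integral_Iic_dataDeriv hv₀, ← setIntegral_Iic_prod_indicator h.integrable_source u v,
      integral_congr_ae (ae_restrict_of_ae hf), ← h0]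
    abel
  have hψ : ∀ u ∈ Icc 0 u₀, ∀ v ∈ Icc 0 v₀,
      ψ u v = wave (φp 0) (dataDeriv u₀ φp) (dataDeriv v₀ φm) f u v := by
    intro u hu v hv
    rw [hw, clamp_of_mem hu, clamp_of_mem hv]
  refine ⟨f, ⟨stronglyMeasurable_dataDeriv, stronglyMeasurable_dataDeriv, mf, ia, ib, intf, ?_, ?_⟩,
    hψ⟩
  · intro u v
    rw [hw]
    simpa using h.mem_sphere _ (clamp_mem hu₀ u) _ (clamp_mem hv₀ v)
  · have hsU : ∀ᵐ u, u ∉ Ioc 0 u₀ → ∀ v, uSlope (dataDeriv u₀ φp) f u v = 0 := by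
      filter_upwards [ae_ae_of_ae hf] with u hu hmem v
      have : ∀ᵐ z, f (u, z) = 0 := by
        filter_upwards [hu] with z hz
        rw [← hz, indicator_of_notMem fun hq => hmem hq.1]
      rw [uSlope, integral_congr_ae (ae_restrict_of_ae this), dataDeriv, indicator_of_notMem hmem]
      simp
    have hsV : ∀ᵐ v, v ∉ Ioc 0 v₀ → ∀ u, vSlope (dataDeriv v₀ φm) f u v = 0 := by
      filter_upwards [ae_ae_of_ae (ae_swap hf)] with v hv hmem u
      have : ∀ᵐ w, f (w, v) = 0 := by
        filter_upwards [hv] with w hw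
        rw [Prod.swap_prod_mk] at hw
        rw [← hw, indicator_of_notMem fun hq => hmem hq.2]
      rw [vSlope, integral_congr_ae (ae_restrict_of_ae this), dataDeriv, indicator_of_notMem hmem]
      simp
    -- The half-open rectangle contains its upper edges, where the derivatives of `ψ` are not
    -- identified; these are null sets.
    have hne : ∀ t : ℝ, ∀ᵐ s : ℝ, s ≠ t := fun t => by simp [ae_iff, measure_singleton]
    filter_upwards [hf, ae_prod_of_ae_fst hsU, ae_prod_of_ae_snd hsV,
      ae_prod_of_ae_fst (ae_hasDerivAt_of_eq_wave hψ ia intf),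
      ae_prod_of_ae_snd (ae_hasDerivAt_of_eq_wave_right hψ ib intf),
      ae_prod_of_ae_fst (hne u₀), ae_prod_of_ae_snd (hne v₀)] with q hq hU hV h1 h2 n1 n2
    by_cases hmem : q ∈ Ioc 0 u₀ ×ˢ Ioc 0 v₀
    · have hu : q.1 ∈ Ioo 0 u₀ := ⟨hmem.1.1, lt_of_le_of_ne hmem.1.2 n1⟩
      have hv : q.2 ∈ Ioo 0 v₀ := ⟨hmem.2.1, lt_of_le_of_ne hmem.2.2 n2⟩
      have hu' := Ioo_subset_Icc_self hu
      have hv' := Ioo_subset_Icc_self hv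
      rw [← hq, indicator_of_mem hmem, hS]
      simp only
      rw [du, dv, (h1 hu q.2 hv').deriv, (h2 hv q.1 hu').deriv, hψ q.1 hu' q.2 hv']
    · rw [← hq, indicator_of_notMem hmem]
      rw [mem_prod, not_and_or] at hmem
      rcases hmem with hm | hm
      · rw [hU hm, inner_zero_left, zero_smul]
      · rw [hV hm, inner_zero_right, zero_smul]

end WaveMaps

/-! ### Energy conservation and convergence -/

section Conclusions

variable {d : ℕ} {u₀ v₀ : ℝ} {φp φm φp' φm' : ℝ → Space d} {f f' : ℝ × ℝ → Space d}
  {ψ ψ' : ℝ → ℝ → Space d}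

/-- Conservation of the `u`-energy along the edge `v = v₀`. -/
theorem IsSolution.conservation_u (hu₀ : 0 < u₀) (hv₀ : 0 ≤ v₀)
    (h : IsSolution (φp 0) (dataDeriv u₀ φp) (dataDeriv v₀ φm) f)
    (hψ : ∀ u ∈ Icc 0 u₀, ∀ v ∈ Icc 0 v₀,
      ψ u v = wave (φp 0) (dataDeriv u₀ φp) (dataDeriv v₀ φm) f u v) :
    (∀ᵐ u ∂(volume.restrict (Icc 0 u₀)), DifferentiableAt ℝ (fun w => ψ w v₀) u) ∧
      IntegrableOn (fun u => du ψ u v₀) (Icc 0 u₀) ∧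
      ∫ u in (0 : ℝ)..u₀, ‖du ψ u v₀‖ = ∫ u in (0 : ℝ)..u₀, ‖deriv φp u‖ := by
  have hd : ∀ᵐ u ∂(volume.restrict (Icc 0 u₀)),
      HasDerivAt (fun w => ψ w v₀) (uSlope (dataDeriv u₀ φp) f u v₀) u := by
    rw [ae_Icc_iff]
    filter_upwards [ae_hasDerivAt_of_eq_wave hψ h.int_a h.int_f] with u hu hmem
    exact hu hmem v₀ ⟨hv₀, le_rfl⟩
  refine ⟨hd.mono fun u hu => hu.differentiableAt, ?_, ?_⟩
  · exact (integrable_uSlope h.int_a h.int_f v₀).integrableOn.congr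
      (hd.mono fun u hu => hu.deriv.symm)
  · rw [intervalIntegral.integral_of_le hu₀.le, intervalIntegral.integral_of_le hu₀.le,
      ← integral_Icc_eq_integral_Ioc, ← integral_Icc_eq_integral_Ioc]
    refine integral_congr_ae ?_
    have hN : ∀ᵐ u ∂(volume.restrict (Icc 0 u₀)),
        ‖uSlope (dataDeriv u₀ φp) f u v₀‖ = ‖deriv φp u‖ := by
      rw [ae_Icc_iff]
      filter_upwards [h.ae_norm_uSlope] with u hu hmem
      rw [hu v₀, dataDeriv, indicator_of_mem (Ioo_subset_Ioc_self hmem)]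
    filter_upwards [hd, hN] with u h1 h2
    simp only [du]
    rw [h1.deriv, h2]

theorem IsSolution.conservation_v (hu₀ : 0 ≤ u₀) (hv₀ : 0 < v₀) (h0 : φp 0 = φm 0)
    (h : IsSolution (φp 0) (dataDeriv u₀ φp) (dataDeriv v₀ φm) f)
    (hψ : ∀ u ∈ Icc 0 u₀, ∀ v ∈ Icc 0 v₀,
      ψ u v = wave (φp 0) (dataDeriv u₀ φp) (dataDeriv v₀ φm) f u v) :
    (∀ᵐ v ∂(volume.restrict (Icc 0 v₀)), DifferentiableAt ℝ (fun z => ψ u₀ z) v) ∧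
      IntegrableOn (fun v => dv ψ u₀ v) (Icc 0 v₀) ∧
      ∫ v in (0 : ℝ)..v₀, ‖dv ψ u₀ v‖ = ∫ v in (0 : ℝ)..v₀, ‖deriv φm v‖ := by
  have hs := h.swap
  rw [h0] at hs
  exact hs.conservation_u (ψ := fun v u => ψ u v) hv₀ hu₀ fun v hv u hu => by
    rw [wave_swap, hψ u hu v hv, h0]

theorem IsSolution.wave_congr (h : IsSolution (φp 0) (dataDeriv u₀ φp) (dataDeriv v₀ φm) f)
    (h' : IsSolution (φp 0) (dataDeriv u₀ φp) (dataDeriv v₀ φm) f') (u v : ℝ) :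
    wave (φp 0) (dataDeriv u₀ φp) (dataDeriv v₀ φm) f u v =
      wave (φp 0) (dataDeriv u₀ φp) (dataDeriv v₀ φm) f' u v := by
  rw [wave, wave, integral_congr_ae (ae_restrict_of_ae (h.ae_eq h'))]

theorem wave_sub {E : Type*} [NormedAddCommGroup E] [InnerProductSpace ℝ E] {c c' : E}
    {a a' b b' : ℝ → E} {f f' : ℝ × ℝ → E} (ha : Integrable a) (ha' : Integrable a')
    (hb : Integrable b) (hb' : Integrable b') (hf : Integrable f) (hf' : Integrable f') (u v : ℝ) :
    wave c' a' b' f' u v - wave c a b f u v = wave (c' - c) (a' - a) (b' - b) (f' - f) u v := by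
  simp only [wave, Pi.sub_apply]
  rw [integral_sub ha'.integrableOn ha.integrableOn, integral_sub hb'.integrableOn
    hb.integrableOn, integral_sub hf'.integrableOn hf.integrableOn]
  abel

/-- By linearity `ψ' - ψ` is itself the wave of the differences, so the result on mixed derivatives
applies to it directly. -/
theorem IsSolution.ae_dudv_sub (h : IsSolution (φp 0) (dataDeriv u₀ φp) (dataDeriv v₀ φm) f)
    (hψ : ∀ u ∈ Icc 0 u₀, ∀ v ∈ Icc 0 v₀,
      ψ u v = wave (φp 0) (dataDeriv u₀ φp) (dataDeriv v₀ φm) f u v)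
    (h' : IsSolution (φp' 0) (dataDeriv u₀ φp') (dataDeriv v₀ φm') f')
    (hψ' : ∀ u ∈ Icc 0 u₀, ∀ v ∈ Icc 0 v₀,
      ψ' u v = wave (φp' 0) (dataDeriv u₀ φp') (dataDeriv v₀ φm') f' u v) :
    ∀ᵐ q ∂(volume.restrict (rect u₀ v₀)),
      dudv (fun u v => ψ' u v - ψ u v) q.1 q.2 = -(f' q - f q) := by
  have key := ae_hasMixed_of_eq_wave (u₀ := u₀) (v₀ := v₀) (ψ := fun u v => ψ' u v - ψ u v)
    (c := φp' 0 - φp 0) (a := dataDeriv u₀ φp' - dataDeriv u₀ φp)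
    (b := dataDeriv v₀ φm' - dataDeriv v₀ φm) (f := f' - f)
    (fun u hu v hv => by
      rw [hψ u hu v hv, hψ' u hu v hv,
        wave_sub h.int_a h'.int_a h.int_b h'.int_b h.int_f h'.int_f])
    (h'.int_b.sub h.int_b) (h'.int_f.sub h.int_f) (h'.meas_f.sub h.meas_f)
  filter_upwards [key] with q hq
  exact hq.2

theorem lintegral_enorm_dataDeriv_sub {s₀ : ℝ} {γ γ' : ℝ → Space d} (h₀ : 0 < s₀)
    (h : IsData s₀ γ) (h' : IsData s₀ γ') :
    ∫⁻ s, ‖dataDeriv s₀ γ' s - dataDeriv s₀ γ s‖ₑ =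
      ENNReal.ofReal (∫ s in (0 : ℝ)..s₀, ‖deriv γ' s - deriv γ s‖) := by
  have e : ∀ s, dataDeriv s₀ γ' s - dataDeriv s₀ γ s =
      (Ioc 0 s₀).indicator (fun s => deriv γ' s - deriv γ s) s := fun s => by
    simp only [dataDeriv, indicator]; split_ifs <;> simp
  have hi : Integrable fun s => dataDeriv s₀ γ' s - dataDeriv s₀ γ s :=
    (h'.integrable_dataDeriv h₀).sub (h.integrable_dataDeriv h₀)
  rw [← ofReal_integral_norm_eq_lintegral_enorm hi, intervalIntegral.integral_of_le h₀.le,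
    ← integral_indicator measurableSet_Ioc]
  congr 2 with s
  rw [e, norm_indicator_eq_indicator_norm]

/-- Convergence of the data implies convergence of the sources in `L¹`. -/
theorem tendsto_lintegral_enorm_sub {φpn φmn : ℕ → ℝ → Space d} {fn : ℕ → ℝ × ℝ → Space d}
    (hu₀ : 0 < u₀) (hv₀ : 0 < v₀) (hφp : IsData u₀ φp) (hφm : IsData v₀ φm)
    (hφpn : ∀ n, IsData u₀ (φpn n)) (hφmn : ∀ n, IsData v₀ (φmn n))
    (h : IsSolution (φp 0) (dataDeriv u₀ φp) (dataDeriv v₀ φm) f)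
    (hn : ∀ n, IsSolution (φpn n 0) (dataDeriv u₀ (φpn n)) (dataDeriv v₀ (φmn n)) (fn n))
    (hlim : Tendsto (fun n => max ‖φpn n 0 - φp 0‖
        (max (∫ u in (0 : ℝ)..u₀, ‖deriv (φpn n) u - deriv φp u‖)
          (∫ v in (0 : ℝ)..v₀, ‖deriv (φmn n) v - deriv φm v‖))) atTop (𝓝 0)) :
    Tendsto (fun n => ∫⁻ q, ‖fn n q - f q‖ₑ) atTop (𝓝 0) := by
  set t : ℕ → ℝ := fun n => max ‖φpn n 0 - φp 0‖
        (max (∫ u in (0 : ℝ)..u₀, ‖deriv (φpn n) u - deriv φp u‖)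
          (∫ v in (0 : ℝ)..v₀, ‖deriv (φmn n) v - deriv φm v‖)) with ht
  set T : ℕ → ℝ≥0∞ := fun n => ENNReal.ofReal (t n)
  have hT : Tendsto T atTop (𝓝 0) := by
    have := ENNReal.tendsto_ofReal hlim
    rwa [ENNReal.ofReal_zero] at this
  have d1 : ∀ n, ‖φpn n 0 - φp 0‖ₑ ≤ T n := fun n => by
    rw [← ofReal_norm]; exact ENNReal.ofReal_le_ofReal (le_max_left _ _)
  have d2 : ∀ n, ∫⁻ s, ‖dataDeriv u₀ (φpn n) s - dataDeriv u₀ φp s‖ₑ ≤ T n := fun n => by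
    rw [lintegral_enorm_dataDeriv_sub hu₀ hφp (hφpn n)]
    exact ENNReal.ofReal_le_ofReal ((le_max_left _ _).trans (le_max_right _ _))
  have d3 : ∀ n, ∫⁻ s, ‖dataDeriv v₀ (φmn n) s - dataDeriv v₀ φm s‖ₑ ≤ T n := fun n => by
    rw [lintegral_enorm_dataDeriv_sub hv₀ hφm (hφmn n)]
    exact ENNReal.ofReal_le_ofReal ((le_max_right _ _).trans (le_max_right _ _))
  set A := ∫⁻ s, ‖dataDeriv u₀ φp s‖ₑ with hAdef
  set B := ∫⁻ s, ‖dataDeriv v₀ φm s‖ₑ with hBdef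
  have hA : A ≠ ∞ := h.int_a.2.ne
  have hB : B ≠ ∞ := h.int_b.2.ne
  have bound : ∀ {x y : ℝ → Space d} {r : ℝ≥0∞}, StronglyMeasurable x → StronglyMeasurable y →
      ∫⁻ s, ‖y s - x s‖ₑ ≤ r → ∫⁻ s, (‖y s‖ₑ + ‖x s‖ₑ) ≤ 2 * (∫⁻ s, ‖x s‖ₑ) + r := by
    intro x y r hx hy hr
    calc ∫⁻ s, (‖y s‖ₑ + ‖x s‖ₑ) ≤ ∫⁻ s, (2 * ‖x s‖ₑ + ‖y s - x s‖ₑ) := by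
          refine lintegral_mono fun s => ?_
          have : ‖y s‖ₑ ≤ ‖y s - x s‖ₑ + ‖x s‖ₑ := by
            simpa using enorm_add_le (y s - x s) (x s)
          calc _ ≤ ‖y s - x s‖ₑ + ‖x s‖ₑ + ‖x s‖ₑ := by gcongr
            _ = _ := by ring
      _ = 2 * (∫⁻ s, ‖x s‖ₑ) + ∫⁻ s, ‖y s - x s‖ₑ := by
          rw [lintegral_add_left (hx.enorm.const_mul 2), lintegral_const_mul _ hx.enorm]
      _ ≤ _ := by gcongr
  -- Once `T n < 1`, the combined masses, at most `2 * A + T n` and `2 * B + T n`, stay below `M`,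
  -- so the Lipschitz constant is independent of `n`.
  set M := 2 * A + 2 * B + 1 with hMdef
  have hM : M ≠ ∞ := by simp [hMdef, ENNReal.mul_eq_top, hA, hB]
  set m := ENNReal.ofReal (Real.exp (-(16 * M).toReal)) *
    ENNReal.ofReal (Real.exp (-(16 * M).toReal))
  have m0 : m ≠ 0 := mul_ne_zero (by simp [Real.exp_pos]) (by simp [Real.exp_pos])
  have m1 : m ≠ ∞ := ENNReal.mul_ne_top ENNReal.ofReal_ne_top ENNReal.ofReal_ne_top
  -- The 6 is the factor 2 of the Lipschitz estimate times three data differences, each at most `T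
  -- n`.
  have hev : ∀ᶠ n in atTop, ∫⁻ q, ‖fn n q - f q‖ₑ ≤ m⁻¹ * (6 * (M + M + M * M)) * T n := by
    filter_upwards [hT.eventually (gt_mem_nhds (zero_lt_one (α := ℝ≥0∞)))] with n hTn
    have bA : ∫⁻ s, (‖dataDeriv u₀ (φpn n) s‖ₑ + ‖dataDeriv u₀ φp s‖ₑ) ≤ M := by
      refine (bound h.meas_a (hn n).meas_a (d2 n)).trans ?_
      calc 2 * A + T n ≤ 2 * A + 1 := by gcongr
        _ ≤ M := by rw [hMdef, add_right_comm]; exact le_self_add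
    have bB : ∫⁻ s, (‖dataDeriv v₀ (φmn n) s‖ₑ + ‖dataDeriv v₀ φm s‖ₑ) ≤ M := by
      refine (bound h.meas_b (hn n).meas_b (d3 n)).trans ?_
      calc 2 * B + T n ≤ 2 * B + 1 := by gcongr
        _ ≤ M := by rw [hMdef, add_assoc]; exact le_add_self
    have key := (hn n).lintegral_enorm_sub_le h hM bA bB
    have hfin : m * ∫⁻ q, ‖fn n q - f q‖ₑ ≤ 6 * (M + M + M * M) * T n := by
      refine key.trans ?_
      calc _ ≤ 2 * ((M + M + M * M) * (T n + T n + T n)) := by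
            gcongr
            · exact d1 n
            · exact d2 n
            · exact d3 n
        _ = _ := by ring
    calc ∫⁻ q, ‖fn n q - f q‖ₑ = m⁻¹ * (m * ∫⁻ q, ‖fn n q - f q‖ₑ) := by
          rw [← mul_assoc, ENNReal.inv_mul_cancel m0 m1, one_mul]
      _ ≤ m⁻¹ * (6 * (M + M + M * M) * T n) := by gcongr
      _ = _ := by ring
  refine tendsto_of_tendsto_of_tendsto_of_le_of_le' tendsto_const_nhds ?_
    (Eventually.of_forall fun _ => zero_le) hev
  have hconst : m⁻¹ * (6 * (M + M + M * M)) ≠ ∞ := by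
    simp [ENNReal.mul_eq_top, m0, hM]
  simpa using ENNReal.Tendsto.const_mul hT (Or.inr hconst)

end Conclusions

end WaveMap

/-! ### The main theorem -/

theorem theorem2 (d : ℕ) (u₀ v₀ : ℝ) (hu₀ : 0 < u₀) (hv₀ : 0 < v₀)
    (φp φm : ℝ → WaveMap.Space d)
    (hφp : WaveMap.IsData u₀ φp) (hφm : WaveMap.IsData v₀ φm) (h0 : φp 0 = φm 0) :
    -- existence and uniqueness on the rectangle
    (∃ φ : ℝ → ℝ → WaveMap.Space d, WaveMap.IsWaveMap u₀ v₀ φp φm φ ∧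
      ∀ ψ : ℝ → ℝ → WaveMap.Space d, WaveMap.IsWaveMap u₀ v₀ φp φm ψ →
        ∀ u ∈ Icc 0 u₀, ∀ v ∈ Icc 0 v₀, ψ u v = φ u v) ∧
    -- the mixed derivative exists almost everywhere and is integrable
    (∀ φ : ℝ → ℝ → WaveMap.Space d, WaveMap.IsWaveMap u₀ v₀ φp φm φ →
      (∀ᵐ p ∂(volume.restrict (WaveMap.rect u₀ v₀)), WaveMap.HasMixed φ p.1 p.2) ∧
      IntegrableOn (fun p : ℝ × ℝ => WaveMap.dudv φ p.1 p.2) (WaveMap.rect u₀ v₀)) ∧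
    -- continuous dependence of the mixed derivative on the boundary data
    (∀ (φ : ℝ → ℝ → WaveMap.Space d) (φpn φmn : ℕ → ℝ → WaveMap.Space d)
      (φn : ℕ → ℝ → ℝ → WaveMap.Space d),
      WaveMap.IsWaveMap u₀ v₀ φp φm φ →
      (∀ n, WaveMap.IsData u₀ (φpn n)) → (∀ n, WaveMap.IsData v₀ (φmn n)) →
      (∀ n, φpn n 0 = φmn n 0) →
      (∀ n, WaveMap.IsWaveMap u₀ v₀ (φpn n) (φmn n) (φn n)) →
      Tendsto (fun n => max ‖φpn n 0 - φp 0‖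
        (max (∫ u in (0 : ℝ)..u₀, ‖deriv (φpn n) u - deriv φp u‖)
          (∫ v in (0 : ℝ)..v₀, ‖deriv (φmn n) v - deriv φm v‖))) atTop (𝓝 0) →
      (∀ n, IntegrableOn
        (fun p : ℝ × ℝ => WaveMap.dudv (fun u v => φn n u v - φ u v) p.1 p.2)
        (WaveMap.rect u₀ v₀)) ∧
      Tendsto (fun n => ∫ p in WaveMap.rect u₀ v₀,
        ‖WaveMap.dudv (fun u v => φn n u v - φ u v) p.1 p.2‖) atTop (𝓝 0)) ∧
    -- pointwise conservation laws
    (∀ φ : ℝ → ℝ → WaveMap.Space d, WaveMap.IsWaveMap u₀ v₀ φp φm φ →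
      ((∀ᵐ u ∂(volume.restrict (Icc 0 u₀)), DifferentiableAt ℝ (fun w => φ w v₀) u) ∧
        IntegrableOn (fun u => WaveMap.du φ u v₀) (Icc 0 u₀) ∧
        ∫ u in (0 : ℝ)..u₀, ‖WaveMap.du φ u v₀‖ = ∫ u in (0 : ℝ)..u₀, ‖deriv φp u‖) ∧
      ((∀ᵐ v ∂(volume.restrict (Icc 0 v₀)), DifferentiableAt ℝ (fun z => φ u₀ z) v) ∧
        IntegrableOn (fun v => WaveMap.dv φ u₀ v) (Icc 0 v₀) ∧
        ∫ v in (0 : ℝ)..v₀, ‖WaveMap.dv φ u₀ v‖ = ∫ v in (0 : ℝ)..v₀, ‖deriv φm v‖)) := by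

  refine ⟨?_, ?_, ?_, ?_⟩
  · obtain ⟨f, hf⟩ := WaveMap.exists_isSolution (c := φp 0)
      WaveMap.stronglyMeasurable_dataDeriv (hφp.integrable_dataDeriv hu₀)
      WaveMap.stronglyMeasurable_dataDeriv (hφm.integrable_dataDeriv hv₀)
      (hφp.norm_add_integral hu₀) (by rw [h0]; exact hφm.norm_add_integral hv₀)
    refine ⟨_, hf.isWaveMap hu₀ hv₀ hφp hφm h0, fun ψ hψ u hu v hv => ?_⟩
    obtain ⟨f', hf', e⟩ := hψ.exists_isSolution hu₀ hv₀ hφp hφm h0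
    rw [e u hu v hv]
    exact hf'.wave_congr hf u v
  · intro φ hφ
    obtain ⟨f, hf, e⟩ := hφ.exists_isSolution hu₀ hv₀ hφp hφm h0
    have key := WaveMap.ae_hasMixed_of_eq_wave e hf.int_b hf.int_f hf.meas_f
    exact ⟨key.mono fun q hq => hq.1,
      hf.int_f.neg.integrableOn.congr (key.mono fun q hq => hq.2.symm)⟩
  · intro φ φpn φmn φn hφ hφpn hφmn h0n hφn hlim
    obtain ⟨f, hf, e⟩ := hφ.exists_isSolution hu₀ hv₀ hφp hφm h0
    choose fn hfn en using fun n => (hφn n).exists_isSolution hu₀ hv₀ (hφpn n) (hφmn n) (h0n n)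
    have hd := fun n => hf.ae_dudv_sub e (hfn n) (en n)
    have hi := fun n => (hfn n).int_f.sub hf.int_f
    refine ⟨fun n => (hi n).neg.integrableOn.congr ((hd n).mono fun q hq => hq.symm), ?_⟩
    have hT := WaveMap.tendsto_lintegral_enorm_sub hu₀ hv₀ hφp hφm hφpn hφmn hf hfn hlim
    have hT' := (ENNReal.tendsto_toReal ENNReal.zero_ne_top).comp hT
    refine squeeze_zero (fun n => integral_nonneg fun _ => norm_nonneg _) (fun n => ?_) hT'
    calc ∫ p in WaveMap.rect u₀ v₀, ‖WaveMap.dudv (fun u v => φn n u v - φ u v) p.1 p.2‖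
        = ∫ p in WaveMap.rect u₀ v₀, ‖fn n p - f p‖ := by
          refine integral_congr_ae ((hd n).mono fun q hq => ?_)
          simp only
          rw [hq, norm_neg]
      _ ≤ ∫ p, ‖fn n p - f p‖ :=
          setIntegral_le_integral (hi n).norm (Eventually.of_forall fun _ => norm_nonneg _)
      _ = _ := integral_norm_eq_lintegral_enorm (hi n).1
  · intro φ hφ
    obtain ⟨f, hf, e⟩ := hφ.exists_isSolution hu₀ hv₀ hφp hφm h0
    exact ⟨hf.conservation_u hu₀ hv₀.le e, hf.conservation_v hu₀.le hv₀ h0 e⟩
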